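/- For $n\ge 0$ and a space $T$, let $\binom{T}{n}$ be the configuration space of $n$-element subsets of $T$ (with the quotient topology from ordered $n$-tuples of distinct points), and for $X\in\binom{\mathbb C}{n}$ let $B_X=\pi_1\big(\binom{\mathbb C}{n},X\big)$ be the braid group based at $X$. An \emph{edge} $e\subset\mathbb C$ is an unoriented smooth ($C^\infty$) embedded compact arc, and $\partial e$ is the set of its two endpoints. Let $\sigma_e\in B_{\partial e}$ be the preferred generator, represented by the loop of two-point configurations in which the two points of $\partial e$ are exchanged by a counterclockwise rotation through the angle $\pi$ about their midpoint. If $X\cap e=\partial e$, the natural injection $\iota_{e;X}\colon B_{\partial e}\to B_X$ is the homomorphism such that, for an open topological disk $U\supset e$ with $X\cap U=\partial e$, the composition of $\iota_{e;X}$ with the map $\pi_1\big(\binom{U}{2},\partial e\big)\to B_{\partial e}$ induced by inclusion is the map $\pi_1\big(\binom{U}{2},\partial e\big)\to B_X$ induced by $S\mapsto S\cup(X\setminus\partial e)$. The \emph{positive $X$-band} defined by $e$ is $\sigma_{e;X}=\iota_{e;X}(\sigma_e)\in B_X$. \textbf{Proposition (basic band relations).} Let $n\ge 2$, let $X\in\binom{\mathbb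 C}{n}$, and let $e,f\subset\mathbb C$ be two edges with $X\cap e=\partial e$ and $X\cap f=\partial f$. Then the positive $X$-bands $\sigma_{e;X},\sigma_{f;X}\in B_X$ are well defined (each exists and is unique, independently of the choices of $U$ and $\iota$), and: (1) if $e\cap f=\emptyset$, then $\sigma_{e;X}\,\sigma_{f;X}\,\sigma_{e;X}^{-1}\,\sigma_{f;X}^{-1}=1$ in $B_X$; (2) if $e\cap f=\{x\}$ with $x\in\partial e\cap\partial f$, then $\sigma_{e;X}\,\sigma_{f;X}\,\sigma_{e;X}\,\sigma_{f;X}^{-1}\,\sigma_{e;X}^{-1}\,\sigma_{f;X}^{-1}=1$ in $B_X$, i.e. $\sigma_{e;X}\sigma_{f;X}\sigma_{e;X}=\sigma_{f;X}\sigma_{e;X}\sigma_{f;X}$. -/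

import Mathlib

open scoped ContDiff commutatorElement

/-- Ordered configurations: `n`-tuples of pairwise distinct points of `T`, with the topology
induced from the product topology on `T ^ n`. -/
abbrev OrderedConfig (n : ℕ) (T : Type*) : Type _ :=
  {v : Fin n → T // Function.Injective v}

/-- The `n`-th configuration space of `T`: the `n`-element subsets of `T`. -/
def Config (n : ℕ) (T : Type*) : Type _ :=
  {S : Finset T // S.card = n}

namespace Config

variable {n : ℕ} {T : Type*}

/-- The underlying finite set of points of a configuration. -/
def points (X : Config n T) : Finset T := X.1

/-- The unordering map, which sends a tuple of distinct points to its set of entries. -/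
def unorder (v : OrderedConfig n T) : Config n T :=
  ⟨Finset.univ.map ⟨v.1, v.2⟩, by simp⟩

@[ext] theorem ext {X Y : Config n T} (h : X.points = Y.points) : X = Y := Subtype.ext h

theorem card_points (X : Config n T) : X.points.card = n := X.2

theorem mem_points_unorder (v : OrderedConfig n T) (z : T) :
    z ∈ (unorder v).points ↔ ∃ i, v.1 i = z := by
  simp [unorder, points]

variable [TopologicalSpace T]

/-- The configuration space carries the quotient topology of the space of ordered configurations
under permutation of the entries; for Hausdorff `T` this is its topology as an (open) subspace of
the symmetric power `T ^ n / S_n`. -/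
instance : TopologicalSpace (Config n T) :=
  TopologicalSpace.coinduced unorder inferInstance

theorem continuous_unorder : Continuous (unorder : OrderedConfig n T → Config n T) :=
  continuous_coinduced_rng

end Config

/-- The braid group based at the configuration `X`: the fundamental group of the
configuration space of the plane with base point `X`. -/
abbrev BraidGroup {n : ℕ} (X : Config n ℂ) : Type :=
  FundamentalGroup (Config n ℂ) X

/-- An edge in the plane: a smooth compact arc, presented as the image of `[0, 1]` under a smooth
curve that restricts to an embedding of `[0, 1]`. Everything below depends only on the image
(`Edge.carrier`) and on its unordered pair of endpoints. -/
structure Edge where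
  param : ℝ → ℂ
  contDiff_param : ContDiff ℝ ∞ param
  injOn_param : Set.InjOn param (Set.Icc 0 1)
  deriv_param_ne : ∀ t ∈ Set.Icc (0 : ℝ) 1, deriv param t ≠ 0

/-- An ordered pair of distinct points. -/
def orderedPair {T : Type*} (a b : T) (h : a ≠ b) : OrderedConfig 2 T :=
  ⟨![a, b], by
    intro i j hij
    fin_cases i <;> fin_cases j <;> simp_all [eq_comm]⟩

/-- The two-point configuration `{a, b}`. -/
def pairConfig {T : Type*} (a b : T) (h : a ≠ b) : Config 2 T :=
  Config.unorder (orderedPair a b h)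

theorem mem_pairConfig {T : Type*} {a b : T} {h : a ≠ b} {z : T} :
    z ∈ (pairConfig a b h).points ↔ z = a ∨ z = b := by
  simp [pairConfig, orderedPair, Config.mem_points_unorder, Fin.exists_fin_two, eq_comm]

theorem rotation_ne (a b : ℂ) (h : a ≠ b) (t : ℝ) :
    (a + b) / 2 + Complex.exp (Real.pi * Complex.I * t) * ((a - b) / 2) ≠
      (a + b) / 2 - Complex.exp (Real.pi * Complex.I * t) * ((a - b) / 2) := by
  intro heq
  have h1 : Complex.exp (Real.pi * Complex.I * t) * (a - b) = 0 := by linear_combination heq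
  rcases mul_eq_zero.1 h1 with h2 | h2
  · exact Complex.exp_ne_zero _ h2
  · exact h (sub_eq_zero.1 h2)

/-- The loop in the space of two-point configurations of the plane in which `a` and `b` are
exchanged by a counterclockwise rotation through the angle `π` about their midpoint. Along it
`(w₁ - w₂) ^ 2` runs once, counterclockwise, around a circle centred at `0`. -/
noncomputable def halfTwistPath (a b : ℂ) (h : a ≠ b) :
    Path (pairConfig a b h) (pairConfig a b h) where
  toFun t := pairConfig
    ((a + b) / 2 + Complex.exp (Real.pi * Complex.I * (t : ℝ)) * ((a - b) / 2))
    ((a + b) / 2 - Complex.exp (Real.pi * Complex.I * (t : ℝ)) * ((a - b) / 2))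
    (rotation_ne a b h t)
  continuous_toFun := by
    refine Config.continuous_unorder.comp (Continuous.subtype_mk ?_ _)
    refine continuous_pi fun i => ?_
    fin_cases i <;> simp <;> fun_prop
  source' := by
    ext z
    simp only [mem_pairConfig]
    norm_num
    ring_nf
  target' := by
    ext z
    simp only [mem_pairConfig]
    norm_num
    ring_nf
    tauto

namespace Edge

/-- The edge as a subset of the plane. -/
def carrier (e : Edge) : Set ℂ := e.param '' Set.Icc 0 1

theorem endpoints_ne (e : Edge) : e.param 0 ≠ e.param 1 := fun h =>
  zero_ne_one (e.injOn_param (by simp) (by simp) h)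

/-- The boundary `∂e` of an edge, as a two-point configuration. -/
def boundary (e : Edge) : Config 2 ℂ :=
  pairConfig (e.param 0) (e.param 1) e.endpoints_ne

/-- The preferred generator `σ_e` of the two-string braid group based at `∂e`. -/
noncomputable def generator (e : Edge) : BraidGroup e.boundary :=
  FundamentalGroup.fromPath (Path.Homotopic.Quotient.mk
    (halfTwistPath (e.param 0) (e.param 1) e.endpoints_ne))

end Edge

/-- For a subset `U` of the plane, the inclusion of the configuration space of `U` into the
configuration space of the plane. -/
noncomputable def includeConfigFun (k : ℕ) (U : Set ℂ) (S : Config k U) : Config k ℂ :=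
  ⟨S.points.map (Function.Embedding.subtype _), by simp [S.card_points]⟩

theorem mem_includeConfigFun {k : ℕ} {U : Set ℂ} {S : Config k U} {z : ℂ} :
    z ∈ (includeConfigFun k U S).points ↔ ∃ w ∈ S.points, (w : ℂ) = z := by
  change z ∈ S.points.map (Function.Embedding.subtype _) ↔ _
  rw [Finset.mem_map]
  rfl

/-- The inclusion of configuration spaces as a continuous map. -/
noncomputable def includeConfig (k : ℕ) (U : Set ℂ) : C(Config k U, Config k ℂ) where
  toFun := includeConfigFun k U
  continuous_toFun := by
    refine continuous_coinduced_dom.2 ?_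
    have hc : ∀ i, Continuous fun v : OrderedConfig k U => (v.1 i : ℂ) := fun i =>
      continuous_subtype_val.comp ((continuous_apply i).comp continuous_subtype_val)
    have : Continuous fun v : OrderedConfig k U =>
        Config.unorder (⟨fun i => (v.1 i : ℂ), Subtype.val_injective.comp v.2⟩ :
          OrderedConfig k ℂ) :=
      Config.continuous_unorder.comp (Continuous.subtype_mk (continuous_pi hc) _)
    refine this.congr fun v => Config.ext (Finset.ext fun z => ?_)
    rw [Function.comp_apply, mem_includeConfigFun, Config.mem_points_unorder]
    simp only [Config.mem_points_unorder]
    constructor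
    · rintro ⟨i, hi⟩
      exact ⟨v.1 i, ⟨i, rfl⟩, hi⟩
    · rintro ⟨_, ⟨i, rfl⟩, hi⟩
      exact ⟨i, hi⟩

/-- For a finite set `R` of points of the plane disjoint from `U`, the map `S ↦ S ∪ R` from
configurations in `U` to configurations in the plane. -/
noncomputable def addPointsFun {k n : ℕ} (U : Set ℂ) (R : Finset ℂ) (hR : ∀ z ∈ R, z ∉ U)
    (hn : k + R.card = n) (S : Config k U) : Config n ℂ :=
  ⟨(includeConfigFun k U S).points ∪ R, by
    rw [Finset.card_union_of_disjoint, Config.card_points, hn]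
    rw [Finset.disjoint_left]
    intro z hz hzR
    obtain ⟨w, -, rfl⟩ := mem_includeConfigFun.1 hz
    exact hR _ hzR w.2⟩

theorem points_addPointsFun {k n : ℕ} {U : Set ℂ} {R : Finset ℂ} {hR : ∀ z ∈ R, z ∉ U}
    {hn : k + R.card = n} {S : Config k U} :
    (addPointsFun U R hR hn S).points = (includeConfigFun k U S).points ∪ R := rfl

/-- The map `S ↦ S ∪ R` as a continuous map. -/
noncomputable def addPoints {k n : ℕ} (U : Set ℂ) (R : Finset ℂ) (hR : ∀ z ∈ R, z ∉ U)
    (hn : k + R.card = n) : C(Config k U, Config n ℂ) where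
  toFun := addPointsFun U R hR hn
  continuous_toFun := by
    subst hn
    refine continuous_coinduced_dom.2 ?_
    have hc : ∀ i, Continuous fun v : OrderedConfig k U => (v.1 i : ℂ) := fun i =>
      continuous_subtype_val.comp ((continuous_apply i).comp continuous_subtype_val)
    let r : Fin R.card → ℂ := fun i => (R.equivFin.symm i : ℂ)
    have hr : Function.Injective r := Subtype.val_injective.comp R.equivFin.symm.injective
    have hinj : ∀ v : OrderedConfig k U,
        Function.Injective (Fin.append (fun i => (v.1 i : ℂ)) r) := fun v => by
      refine Fin.append_injective_iff.2 ⟨Subtype.val_injective.comp v.2, hr, ?_⟩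
      intro i j hij
      exact hR (r j) (R.equivFin.symm j).2 (hij ▸ (v.1 i).2 : r j ∈ U)
    have hcont : Continuous fun v : OrderedConfig k U =>
        Config.unorder (⟨Fin.append (fun i => (v.1 i : ℂ)) r, hinj v⟩ :
          OrderedConfig (k + R.card) ℂ) := by
      refine Config.continuous_unorder.comp (Continuous.subtype_mk ?_ _)
      refine continuous_pi fun i => ?_
      refine Fin.addCases (fun i => ?_) (fun i => ?_) i
      · simpa only [Fin.append_left] using hc i
      · simpa only [Fin.append_right] using continuous_const
    refine hcont.congr fun v => Config.ext (Finset.ext fun z => ?_)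
    rw [Function.comp_apply, points_addPointsFun, Finset.mem_union, mem_includeConfigFun,
      Config.mem_points_unorder]
    simp only [Config.mem_points_unorder]
    constructor
    · rintro ⟨i, rfl⟩
      refine Fin.addCases (fun i => ?_) (fun i => ?_) i
      · exact Or.inl ⟨v.1 i, ⟨i, rfl⟩, by simp⟩
      · exact Or.inr (by simp [r])
    · rintro (⟨_, ⟨i, rfl⟩, rfl⟩ | hz)
      · exact ⟨Fin.castAdd _ i, by simp⟩
      · exact ⟨Fin.natAdd _ (R.equivFin ⟨z, hz⟩), by simp [r]⟩

/-- An open disk `U` in the plane that contains the edge `e` and meets the configuration `X`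
exactly in the endpoints of `e`. -/
structure DiskNeighborhood {n : ℕ} (X : Config n ℂ) (e : Edge) where
  U : Set ℂ
  isOpen : IsOpen U
  isDisk : Nonempty (U ≃ₜ ℂ)
  carrier_subset : e.carrier ⊆ U
  inter_eq : (X.points : Set ℂ) ∩ U = e.boundary.points

namespace DiskNeighborhood

variable {n : ℕ} {X : Config n ℂ} {e : Edge}

/-- The boundary `∂e` as a two-point configuration in the disk. -/
def base (N : DiskNeighborhood X e) : Config 2 N.U :=
  pairConfig ⟨e.param 0, N.carrier_subset ⟨0, by simp, rfl⟩⟩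
    ⟨e.param 1, N.carrier_subset ⟨1, by simp, rfl⟩⟩
    fun h => e.endpoints_ne (congrArg Subtype.val h)

theorem boundary_subset (N : DiskNeighborhood X e) :
    e.boundary.points ⊆ X.points := fun z hz => by
  have h : z ∈ (X.points : Set ℂ) ∩ N.U := by rw [N.inter_eq]; exact hz
  exact h.1

theorem remaining_notMem (N : DiskNeighborhood X e) :
    ∀ z ∈ X.points \ e.boundary.points, z ∉ N.U := fun z hz hU => by
  rw [Finset.mem_sdiff] at hz
  have h : z ∈ (X.points : Set ℂ) ∩ N.U := ⟨hz.1, hU⟩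
  rw [N.inter_eq] at h
  exact hz.2 h

theorem card_remaining (N : DiskNeighborhood X e) :
    2 + (X.points \ e.boundary.points).card = n := by
  have h := Finset.card_sdiff_add_card_eq_card N.boundary_subset
  rw [e.boundary.card_points, X.card_points] at h
  omega

theorem includeConfig_base (N : DiskNeighborhood X e) :
    includeConfig 2 N.U N.base = e.boundary := by
  refine Config.ext (Finset.ext fun z => ?_)
  change z ∈ (includeConfigFun 2 N.U N.base).points ↔ _
  rw [mem_includeConfigFun]
  simp only [base, Edge.boundary, mem_pairConfig]
  constructor
  · rintro ⟨w, rfl | rfl, rfl⟩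
    · exact Or.inl rfl
    · exact Or.inr rfl
  · rintro (rfl | rfl)
    · exact ⟨_, Or.inl rfl, rfl⟩
    · exact ⟨_, Or.inr rfl, rfl⟩

/-- The map `S ↦ S ∪ (X \ ∂e)`, from two-point configurations in the disk to
`n`-point configurations in the plane. -/
noncomputable def extend (N : DiskNeighborhood X e) : C(Config 2 N.U, Config n ℂ) :=
  addPoints N.U (X.points \ e.boundary.points) N.remaining_notMem N.card_remaining

theorem extend_base (N : DiskNeighborhood X e) : N.extend N.base = X := by
  refine Config.ext ?_
  change (includeConfig 2 N.U N.base).points ∪ (X.points \ e.boundary.points) = _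
  rw [N.includeConfig_base, Finset.union_sdiff_of_subset N.boundary_subset]

end DiskNeighborhood

/-- `ι` is the natural injection `B_{∂e} → B_X`: for some disk neighborhood `U` of `e` with
`X ∩ U = ∂e`, it sends the image in `B_{∂e}` of a two-string braid in `U` to the `n`-string braid
obtained by adding the remaining points of `X` as constant strings. -/
def IsNaturalInjection {n : ℕ} (X : Config n ℂ) (e : Edge)
    (ι : BraidGroup e.boundary →* BraidGroup X) : Prop :=
  ∃ N : DiskNeighborhood X e,
    ι.comp (FundamentalGroup.mapOfEq (includeConfig 2 N.U) N.includeConfig_base) =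
      FundamentalGroup.mapOfEq N.extend N.extend_base

/-- `β` is the positive `X`-band defined by `e`, that is, the image of the preferred generator
`σ_e` under the natural injection `B_{∂e} → B_X`. -/
def IsPositiveBand {n : ℕ} (X : Config n ℂ) (e : Edge) (β : BraidGroup X) : Prop :=
  ∃ ι : BraidGroup e.boundary →* BraidGroup X, IsNaturalInjection X e ι ∧ ι e.generator = β

/-- The yangbaxter of two elements of a group; it is trivial iff `g h g = h g h`. -/
def yangBaxter {G : Type*} [Group G] (g h : G) : G := g * h * g * h⁻¹ * g⁻¹ * h⁻¹

/-! The proof replaces positive bands by explicit loops. For an arc `g` avoiding a set `R` of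
resting points, slide `g 1` along the arc to `g ε`, turn the pair `g 0`, `g ε` by the angle `π`
about its midpoint, and slide back (`IsBand`). This makes sense as soon as the disks with diameters
`[g 0, g s]`, `s ≤ ε`, miss `R`. The class does not depend on `ε` (`IsBand.eq_of_le`), and an
isotopy of the arc together with its resting points conjugates the band by the path that the
configuration traces (`IsArcBand.trans_eq`). Every homotopy needed is a square of configurations
given by a continuous family of injective tuples.

Well-definedness. A tubular neighbourhood of the edge provides a disk `U`. The map `(m, z) ↦ {m +
exp z, m - exp z}` is a covering by `ℂ × ℂ` whose deck group is generated by translation by `(0, π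
i)`, so the two-string braid group is infinite cyclic, generated by the half twist. The two-string
group of `U` is cyclic as well and its image contains the half twist, so inclusion induces an
isomorphism; inverting it constructs the natural injection. For uniqueness, one and the same small
loop in `U` maps to the band along the edge in both configuration spaces
(`DiskNeighborhood.exists_isArcBand`), so every positive band is the band along the arc, whatever
`U` and `ι` are (`IsPositiveBand.isArcBand`).

Disjoint edges. The loop for `f` can be run in the complement of `e`. The band along the motionless
arc `e` is then carried around this loop to itself, which says that the two bands commute
(`IsArcBand.trans_comm`).

Edges with one common endpoint. Together they form a long arc. The braid relation is invariant under
isotopy of the long arc (`BraidRelation.of_isotopy`), and shrinking towards a free endpoint,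
followed by interpolation to the tangent, leads to two consecutive unit segments in an affine
coordinate (`BraidRelation.of_hasStrictDerivAt`). For the segments `[0, 1]` and `[1, 2]`, with bands
`α` and `β`, let `δ` be the band along an arc from `0` to `2` passing above `1`. Carrying arcs along
the half twists gives `β α = α δ` and `δ β = β α` as composites of loops, hence `α β α = α δ β = β α
β` (`braidRelation_straight`). -/

open unitInterval Topology

/-! ### Paths and squares of configurations obtained from moving tuples. -/

namespace Config

/-- A continuous family of tuples of pairwise distinct points defines a continuous family of
configurations. -/
theorem exists_map {n : ℕ} {T Y ι : Type*} [TopologicalSpace T] [TopologicalSpace Y] [Fintype ι]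
    (hι : Fintype.card ι = n) (w : Y → ι → T) (hw : Continuous w)
    (hinj : ∀ y, Function.Injective (w y)) :
    ∃ F : C(Y, Config n T), ∀ y, ((F y).points : Set T) = Set.range (w y) := by
  let e : Fin n ≃ ι := (Fintype.equivFinOfCardEq hι).symm
  refine ⟨⟨fun y => unorder ⟨w y ∘ e, (hinj y).comp e.injective⟩,
    continuous_unorder.comp (Continuous.subtype_mk ?_ _)⟩, fun y => ?_⟩
  · exact continuous_pi fun i => (continuous_apply (e i)).comp hw
  · ext z
    rw [Finset.mem_coe]
    refine (mem_points_unorder _ _).trans ?_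
    exact (e.surjective.exists (p := fun i => w y i = z)).symm

theorem ext_coe {n : ℕ} {T : Type*} {X Y : Config n T}
    (h : (X.points : Set T) = Y.points) : X = Y :=
  Config.ext (Finset.coe_injective h)

theorem exists_path {n : ℕ} {T ι : Type*} [TopologicalSpace T] [Fintype ι]
    (hι : Fintype.card ι = n) (w : I → ι → T) (hw : Continuous w)
    (hinj : ∀ t, Function.Injective (w t)) {X Y : Config n T}
    (hX : (X.points : Set T) = Set.range (w 0)) (hY : (Y.points : Set T) = Set.range (w 1)) :
    ∃ P : Path X Y, ∀ t, ((P t).points : Set T) = Set.range (w t) := by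
  obtain ⟨F, hF⟩ := exists_map hι w hw hinj
  exact ⟨⟨F, ext_coe ((hF 0).trans hX.symm), ext_coe ((hF 1).trans hY.symm)⟩, hF⟩

end Config

/-- The two ways around the boundary of a square are homotopic. -/
theorem Path.Homotopic.Quotient.trans_eq_trans_of_square {Y : Type*} [TopologicalSpace Y]
    (F : C(I × I, Y)) {a b c d : Y} (p : Path a b) (q : Path b d) (r : Path a c) (s : Path c d)
    (hp : ∀ t, p t = F (t, 0)) (hq : ∀ t, q t = F (1, t))
    (hr : ∀ t, r t = F (0, t)) (hs : ∀ t, s t = F (t, 1)) :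
    (Path.Homotopic.Quotient.mk p).trans (.mk q) =
      (Path.Homotopic.Quotient.mk r).trans (.mk s) := by
  have ha : a = F (0, 0) := p.source.symm.trans (hp 0)
  have hb : b = F (1, 0) := p.target.symm.trans (hp 1)
  have hc : c = F (0, 1) := r.target.symm.trans (hr 1)
  have hd : d = F (1, 1) := q.target.symm.trans (hq 1)
  subst ha hb hc hd
  let p' : Path ((0, 0) : I × I) (1, 0) := ⟨⟨fun t => (t, 0), by fun_prop⟩, rfl, rfl⟩
  let q' : Path ((1, 0) : I × I) (1, 1) := ⟨⟨fun t => (1, t), by fun_prop⟩, rfl, rfl⟩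
  let r' : Path ((0, 0) : I × I) (0, 1) := ⟨⟨fun t => (0, t), by fun_prop⟩, rfl, rfl⟩
  let s' : Path ((0, 1) : I × I) (1, 1) := ⟨⟨fun t => (t, 1), by fun_prop⟩, rfl, rfl⟩
  have hp' : p = p'.map F.continuous := Path.ext (funext hp)
  have hq' : q = q'.map F.continuous := Path.ext (funext hq)
  have hr' : r = r'.map F.continuous := Path.ext (funext hr)
  have hs' : s = s'.map F.continuous := Path.ext (funext hs)
  have : ContractibleSpace I :=
    (convex_Icc (0 : ℝ) 1).contractibleSpace ⟨0, Set.left_mem_Icc.2 zero_le_one⟩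
  rw [hp', hq', hr', hs', ← mk_trans, ← mk_trans, ← Path.map_trans, ← Path.map_trans]
  -- Both routes are images of paths with common endpoints in the simply connected square.
  exact Quotient.eq.2 ((SimplyConnectedSpace.paths_homotopic (p'.trans q') (r'.trans s')).map F)

namespace Config

/-- The two ways around the boundary of a square of configurations are homotopic. -/
theorem trans_eq_trans_of_motion {n : ℕ} {T ι : Type*} [TopologicalSpace T] [Fintype ι]
    (hι : Fintype.card ι = n) (w : I × I → ι → T) (hw : Continuous w)
    (hinj : ∀ t, Function.Injective (w t)) {a b c d : Config n T}
    (p : Path a b) (q : Path b d) (r : Path a c) (s : Path c d)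
    (hp : ∀ t, ((p t).points : Set T) = Set.range (w (t, 0)))
    (hq : ∀ t, ((q t).points : Set T) = Set.range (w (1, t)))
    (hr : ∀ t, ((r t).points : Set T) = Set.range (w (0, t)))
    (hs : ∀ t, ((s t).points : Set T) = Set.range (w (t, 1))) :
    (Path.Homotopic.Quotient.mk p).trans (.mk q) =
      (Path.Homotopic.Quotient.mk r).trans (.mk s) := by
  obtain ⟨F, hF⟩ := exists_map hι w hw hinj
  exact Path.Homotopic.Quotient.trans_eq_trans_of_square F p q r s
    (fun t => ext_coe ((hp t).trans (hF _).symm)) (fun t => ext_coe ((hq t).trans (hF _).symm))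
    (fun t => ext_coe ((hr t).trans (hF _).symm)) (fun t => ext_coe ((hs t).trans (hF _).symm))

end Config

/-! ### Rotating pairs, and tuples with a distinguished pair. -/

/-- The image of `a` under the rotation through the angle `π * t` about the midpoint of `a`
and `b`. -/
noncomputable def rotPoint (a b : ℂ) (t : ℝ) : ℂ :=
  (a + b) / 2 + Complex.exp (Real.pi * Complex.I * t) * ((a - b) / 2)

theorem rotPoint_zero (a b : ℂ) : rotPoint a b 0 = a := by
  simp [rotPoint]; ring

theorem rotPoint_one (a b : ℂ) : rotPoint a b 1 = b := by
  simp [rotPoint]; ring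

theorem rotPoint_ne {a b : ℂ} (h : a ≠ b) (t : ℝ) : rotPoint a b t ≠ rotPoint b a t := by
  have h2 : rotPoint b a t =
      (a + b) / 2 - Complex.exp (Real.pi * Complex.I * t) * ((a - b) / 2) := by
    unfold rotPoint; ring
  rw [h2]
  exact rotation_ne a b h t

theorem dist_rotPoint (a b : ℂ) (t : ℝ) : dist (rotPoint a b t) ((a + b) / 2) = dist a b / 2 := by
  have : Real.pi * Complex.I * t = ((Real.pi * t : ℝ) : ℂ) * Complex.I := by push_cast; ring
  rw [dist_eq_norm, rotPoint, add_sub_cancel_left, norm_mul, this, Complex.norm_exp_ofReal_mul_I,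
    dist_eq_norm, norm_div]
  simp

@[fun_prop]
theorem continuous_rotPoint {Y : Type*} [TopologicalSpace Y] {a b : Y → ℂ} {t : Y → ℝ}
    (ha : Continuous a) (hb : Continuous b) (ht : Continuous t) :
    Continuous fun y => rotPoint (a y) (b y) (t y) := by
  unfold rotPoint; fun_prop

theorem rotPoint_affine (c w a b : ℂ) (t : ℝ) :
    rotPoint (c + w * a) (c + w * b) t = c + w * rotPoint a b t := by
  unfold rotPoint; ring

section PairFamily

variable {T κ : Type*}

/-- The family consisting of `a`, `b` and the family `r`. -/
def pairFamily (a b : T) (r : κ → T) : Fin 2 ⊕ κ → T := Sum.elim ![a, b] r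

theorem range_pairFamily (a b : T) (r : κ → T) :
    Set.range (pairFamily a b r) = {a, b} ∪ Set.range r := by
  rw [pairFamily, Set.Sum.elim_range]
  simp [Matrix.range_cons, Set.pair_comm]

theorem pairFamily_injective {a b : T} {r : κ → T} (hab : a ≠ b) (hr : Function.Injective r)
    (ha : a ∉ Set.range r) (hb : b ∉ Set.range r) : Function.Injective (pairFamily a b r) := by
  refine Function.Injective.sumElim ?_ hr ?_
  · exact (orderedPair a b hab).2
  · intro i k hik
    fin_cases i
    · exact ha ⟨k, hik.symm⟩
    · exact hb ⟨k, hik.symm⟩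

theorem continuous_pairFamily {Y : Type*} [TopologicalSpace T] [TopologicalSpace Y] {a b : Y → T}
    {r : Y → κ → T} (ha : Continuous a) (hb : Continuous b) (hr : Continuous r) :
    Continuous fun y => pairFamily (a y) (b y) (r y) := by
  refine continuous_pi fun i => ?_
  rcases i with i | k
  · fin_cases i
    · exact ha
    · exact hb
  · exact (continuous_apply k).comp hr

theorem card_sum_two [Fintype κ] {n : ℕ} (h : Fintype.card κ + 2 = n) :
    Fintype.card (Fin 2 ⊕ κ) = n := by
  rw [Fintype.card_sum, Fintype.card_fin]; omega

end PairFamily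

/-! ### Band loops along arcs. -/

/-- `g` restricts to an arc on `[0, 1]` that avoids the set `R`. -/
structure IsArcAvoiding (R : Set ℂ) (g : ℝ → ℂ) : Prop where
  continuous : Continuous g
  injOn : Set.InjOn g (Set.Icc 0 1)
  notMem : ∀ s ∈ Set.Icc (0 : ℝ) 1, g s ∉ R

/-- The closed disks with diameters `[g 0, g s]`, for `0 ≤ s ≤ ε`, avoid the set `R`. -/
structure IsClear (R : Set ℂ) (g : ℝ → ℂ) (ε : ℝ) : Prop where
  pos : 0 < ε
  le_one : ε ≤ 1
  lt_dist : ∀ s ∈ Set.Icc 0 ε, ∀ z ∈ R, dist (g 0) (g s) / 2 < dist z ((g 0 + g s) / 2)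

/-- `β` is the class of the loop that contracts the arc `g` to its initial part `g [0, ε]`,
exchanges `g 0` and `g ε` by a rotation through the angle `π` about their midpoint, and expands
the arc again, while the points of `R` are fixed. -/
def IsBand {n : ℕ} (R : Set ℂ) (g : ℝ → ℂ) (ε : ℝ) {X : Config n ℂ}
    (β : Path.Homotopic.Quotient X X) : Prop :=
  ∃ (Y : Config n ℂ) (γ : Path X Y) (τ : Path Y Y),
    (∀ t : I, ((γ t).points : Set ℂ) = {g 0, g (1 - t * (1 - ε))} ∪ R) ∧
    (∀ t : I, ((τ t).points : Set ℂ) =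
      {rotPoint (g 0) (g ε) t, rotPoint (g ε) (g 0) t} ∪ R) ∧
    β = (Path.Homotopic.Quotient.mk γ).trans
      ((Path.Homotopic.Quotient.mk τ).trans (Path.Homotopic.Quotient.mk γ).symm)

/-- The rotating point stays on the circle with diameter `[g 0, g s]`, and all of `R` lies strictly
outside this circle. -/
theorem IsClear.rotPoint_notMem {R : Set ℂ} {g : ℝ → ℂ} {ε s : ℝ} (h : IsClear R g ε)
    (hs : s ∈ Set.Icc 0 ε) (t : ℝ) : rotPoint (g 0) (g s) t ∉ R := fun hR =>
  absurd (dist_rotPoint (g 0) (g s) t) (h.lt_dist s hs _ hR).ne'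

theorem IsClear.rotPoint_notMem' {R : Set ℂ} {g : ℝ → ℂ} {ε s : ℝ} (h : IsClear R g ε)
    (hs : s ∈ Set.Icc 0 ε) (t : ℝ) : rotPoint (g s) (g 0) t ∉ R := fun hR =>
  absurd (dist_rotPoint (g s) (g 0) t)
    (by rw [dist_comm (g s), add_comm (g s)]; exact (h.lt_dist s hs _ hR).ne')

theorem IsArcAvoiding.zero_ne {R : Set ℂ} {g : ℝ → ℂ} (h : IsArcAvoiding R g) {s : ℝ}
    (hs : 0 < s) (hs1 : s ≤ 1) : g 0 ≠ g s := fun he =>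
  hs.ne (h.injOn ⟨le_rfl, zero_le_one⟩ ⟨hs.le, hs1⟩ he)

theorem IsArcAvoiding.pairFamily_injective {κ : Type*} {r : κ → ℂ} {g : ℝ → ℂ}
    (h : IsArcAvoiding (Set.range r) g) (hr : Function.Injective r) {s : ℝ}
    (hs : 0 < s) (hs1 : s ≤ 1) : Function.Injective (pairFamily (g 0) (g s) r) :=
  _root_.pairFamily_injective (h.zero_ne hs hs1) hr (h.notMem 0 ⟨le_rfl, zero_le_one⟩)
    (h.notMem s ⟨hs.le, hs1⟩)

theorem IsArcAvoiding.pairFamily_rotPoint_injective {κ : Type*} {r : κ → ℂ} {g : ℝ → ℂ}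
    (h : IsArcAvoiding (Set.range r) g) (hr : Function.Injective r) {ε s : ℝ}
    (hε : IsClear (Set.range r) g ε) (hs : 0 < s) (hs1 : s ≤ ε) (t : ℝ) :
    Function.Injective (pairFamily (rotPoint (g 0) (g s) t) (rotPoint (g s) (g 0) t) r) :=
  _root_.pairFamily_injective (rotPoint_ne (h.zero_ne hs (hs1.trans hε.le_one)) t) hr
    (hε.rotPoint_notMem ⟨hs.le, hs1⟩ t) (hε.rotPoint_notMem' ⟨hs.le, hs1⟩ t)

/-- The sliding parameter runs in `[ε, 1]`; staying away from `0` keeps the sliding point different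
from `g 0`. -/
theorem one_sub_mul_mem {ε : ℝ} (h1 : ε ≤ 1) (t : I) :
    1 - (t : ℝ) * (1 - ε) ∈ Set.Icc ε 1 := by
  have h2 := t.2.1
  have h3 := t.2.2
  constructor <;> nlinarith

/-! ### Isotopy invariance of bands and independence of `ε`. -/

section Isotopy

variable {n : ℕ} {κ : Type*} [Fintype κ]

/-- Existence of the band loop, for given rest points and sufficiently small `ε`. -/
theorem exists_isBand_range (hκ : Fintype.card κ + 2 = n) {r : κ → ℂ}
    (hr : Function.Injective r) {g : ℝ → ℂ} {ε : ℝ}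
    (hg : IsArcAvoiding (Set.range r) g) (hε : IsClear (Set.range r) g ε) {X : Config n ℂ}
    (hX : (X.points : Set ℂ) = {g 0, g 1} ∪ Set.range r) :
    ∃ β : Path.Homotopic.Quotient X X, IsBand (Set.range r) g ε β := by
  have hcont := hg.continuous
  obtain ⟨F, hF⟩ := Config.exists_map (card_sum_two hκ)
    (fun t : I => pairFamily (g 0) (g (1 - t * (1 - ε))) r)
    (continuous_pairFamily (by fun_prop) (by fun_prop) continuous_const)
    (fun t => have h := one_sub_mul_mem hε.le_one t
      hg.pairFamily_injective hr (hε.pos.trans_le h.1) h.2)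
  let γ : Path X (F 1) := ⟨F, Config.ext_coe (by
    change ((F 0).points : Set ℂ) = _
    rw [hF, hX, range_pairFamily]; simp), rfl⟩
  obtain ⟨τ, hτ⟩ := Config.exists_path (card_sum_two hκ)
    (fun t : I => pairFamily (rotPoint (g 0) (g ε) t) (rotPoint (g ε) (g 0) t) r)
    (continuous_pairFamily (by fun_prop) (by fun_prop) continuous_const)
    (fun t => hg.pairFamily_rotPoint_injective hr hε hε.pos le_rfl t) (X := F 1) (Y := F 1)
    (by rw [hF, range_pairFamily, range_pairFamily]; simp [rotPoint_zero])
    (by rw [hF, range_pairFamily, range_pairFamily]; simp [rotPoint_one, Set.pair_comm])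
  refine ⟨_, F 1, γ, τ, fun t => ?_, fun t => ?_, rfl⟩
  · exact (hF t).trans (range_pairFamily _ _ _)
  · rw [hτ, range_pairFamily]

/-- The band loop is carried along by an isotopy of the arc and the rest points. -/
theorem IsBand.trans_eq_of_isClear (hκ : Fintype.card κ + 2 = n) {r : I → κ → ℂ}
    (hrc : Continuous r) (hr : ∀ t, Function.Injective (r t)) {H : I → ℝ → ℂ}
    (hHc : Continuous (Function.uncurry H)) {ε : ℝ}
    (hH : ∀ t, IsArcAvoiding (Set.range (r t)) (H t))
    (hε : ∀ t, IsClear (Set.range (r t)) (H t) ε) {X Y : Config n ℂ} (Γ : Path X Y)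
    (hΓ : ∀ t, ((Γ t).points : Set ℂ) = {H t 0, H t 1} ∪ Set.range (r t))
    {β : Path.Homotopic.Quotient X X} {β' : Path.Homotopic.Quotient Y Y}
    (hβ : IsBand (Set.range (r 0)) (H 0) ε β) (hβ' : IsBand (Set.range (r 1)) (H 1) ε β') :
    β.trans (.mk Γ) = (Path.Homotopic.Quotient.mk Γ).trans β' := by
  obtain ⟨X', γ, τ, hγ, hτ, rfl⟩ := hβ
  obtain ⟨Y', γ', τ', hγ', hτ', rfl⟩ := hβ'
  have hHc' : ∀ {Z : Type} [TopologicalSpace Z] {a : Z → I} {b : Z → ℝ}, Continuous a →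
      Continuous b → Continuous fun z => H (a z) (b z) := fun ha hb => hHc.comp (ha.prodMk hb)
  have hε0 := (hε 0).pos
  have hε1 := (hε 0).le_one
  -- The path traced by the contracted configuration during the isotopy. Conjugation by `Γ` is
  -- compared with conjugation by `Γ'` through the contraction square `h1`, and the turn commutes
  -- with the isotopy by the square `h2`.
  obtain ⟨Γ', hΓ'⟩ := Config.exists_path (card_sum_two hκ)
    (fun t : I => pairFamily (H t 0) (H t ε) (r t))
    (continuous_pairFamily (hHc' continuous_id continuous_const)
      (hHc' continuous_id continuous_const) hrc)
    (fun t => (hH t).pairFamily_injective (hr t) hε0 hε1) (X := X') (Y := Y')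
    (by rw [← γ.target, hγ, range_pairFamily]; simp)
    (by rw [← γ'.target, hγ', range_pairFamily]; simp)
  have h1 : (Path.Homotopic.Quotient.mk Γ).trans (.mk γ') =
      (Path.Homotopic.Quotient.mk γ).trans (.mk Γ') := by
    refine Config.trans_eq_trans_of_motion (card_sum_two hκ)
      (fun p : I × I => pairFamily (H p.1 0) (H p.1 (1 - p.2 * (1 - ε))) (r p.1))
      (continuous_pairFamily (hHc' continuous_fst continuous_const)
        (hHc' continuous_fst (by fun_prop)) (hrc.comp continuous_fst))
      (fun p => have h := one_sub_mul_mem hε1 p.2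
        (hH p.1).pairFamily_injective (hr p.1) (hε0.trans_le h.1) h.2) _ _ _ _ ?_ ?_ ?_ ?_
    · intro t; rw [hΓ, range_pairFamily]; simp
    · intro t; rw [hγ', range_pairFamily]
    · intro t; rw [hγ, range_pairFamily]
    · intro t; rw [hΓ', range_pairFamily, range_pairFamily]; simp
  have h2 : (Path.Homotopic.Quotient.mk Γ').trans (.mk τ') =
      (Path.Homotopic.Quotient.mk τ).trans (.mk Γ') := by
    refine Config.trans_eq_trans_of_motion (card_sum_two hκ)
      (fun p : I × I => pairFamily (rotPoint (H p.1 0) (H p.1 ε) p.2)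
        (rotPoint (H p.1 ε) (H p.1 0) p.2) (r p.1))
      (continuous_pairFamily
        (continuous_rotPoint (hHc' continuous_fst continuous_const)
          (hHc' continuous_fst continuous_const) (by fun_prop))
        (continuous_rotPoint (hHc' continuous_fst continuous_const)
          (hHc' continuous_fst continuous_const) (by fun_prop)) (hrc.comp continuous_fst))
      (fun p => (hH p.1).pairFamily_rotPoint_injective (hr p.1) (hε p.1) hε0 le_rfl p.2)
      _ _ _ _ ?_ ?_ ?_ ?_
    · intro t; rw [hΓ', range_pairFamily, range_pairFamily]; simp [rotPoint_zero]
    · intro t; rw [hτ', range_pairFamily]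
    · intro t; rw [hτ, range_pairFamily]
    · intro t; rw [hΓ', range_pairFamily, range_pairFamily]; simp [rotPoint_one, Set.pair_comm]
  have h3 : (Path.Homotopic.Quotient.mk γ).symm.trans (.mk Γ) =
      (Path.Homotopic.Quotient.mk Γ').trans (Path.Homotopic.Quotient.mk γ').symm := by
    calc (Path.Homotopic.Quotient.mk γ).symm.trans (.mk Γ)
      _ = (Path.Homotopic.Quotient.mk γ).symm.trans
            (((Path.Homotopic.Quotient.mk Γ).trans (.mk γ')).trans
              (Path.Homotopic.Quotient.mk γ').symm) := by simp
      _ = ((Path.Homotopic.Quotient.mk γ).symm.trans (.mk γ)).trans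
            ((Path.Homotopic.Quotient.mk Γ').trans (Path.Homotopic.Quotient.mk γ').symm) := by
          rw [h1]; simp only [Path.Homotopic.Quotient.trans_assoc]
      _ = _ := by simp
  rw [Path.Homotopic.Quotient.trans_assoc, Path.Homotopic.Quotient.trans_assoc, h3,
    ← Path.Homotopic.Quotient.trans_assoc (.mk τ), ← h2, Path.Homotopic.Quotient.trans_assoc,
    ← Path.Homotopic.Quotient.trans_assoc (.mk γ), ← h1, Path.Homotopic.Quotient.trans_assoc]

/-- The band loop does not depend on `ε`. -/
theorem IsBand.eq_of_le (hκ : Fintype.card κ + 2 = n) {r : κ → ℂ} (hr : Function.Injective r)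
    {g : ℝ → ℂ} {ε δ : ℝ} (hg : IsArcAvoiding (Set.range r) g) (hε : IsClear (Set.range r) g ε)
    (hδ : 0 < δ) (hδε : δ ≤ ε) {X : Config n ℂ} {β β' : Path.Homotopic.Quotient X X}
    (hβ : IsBand (Set.range r) g ε β) (hβ' : IsBand (Set.range r) g δ β') : β = β' := by
  obtain ⟨Y, γ, τ, hγ, hτ, rfl⟩ := hβ
  obtain ⟨Y', γ', τ', hγ', hτ', rfl⟩ := hβ'
  have hcont := hg.continuous
  have hmem : ∀ t : I, (1 - t : ℝ) * ε + t * δ ∈ Set.Icc δ ε := fun t => by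
    have h2 := t.2.1
    have h3 := t.2.2
    constructor <;> nlinarith
  -- A convex combination of `1`, `ε` and `δ`: it equals `1` at the corner `(0, 0)`, `ε` at `(1, 0)`
  -- and `δ` along the whole side `s = 1`. Sliding to `ε` and on to `δ` is thereby deformed into
  -- sliding to `δ` directly.
  have hmem' : ∀ t s : I, (1 - t) * (1 - s) + t * (1 - s) * ε + s * δ ∈ Set.Icc δ 1 :=
    fun t s => by
    have h2 := t.2.1
    have h3 := t.2.2
    have h4 := s.2.1
    have h5 := s.2.2
    have h6 := hε.le_one
    have h7 : (t : ℝ) * (1 - s) * ε ≤ t * (1 - s) * 1 :=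
      mul_le_mul_of_nonneg_left h6 (mul_nonneg h2 (by linarith))
    have h8 : (t : ℝ) * (1 - s) * δ ≤ t * (1 - s) * ε :=
      mul_le_mul_of_nonneg_left hδε (mul_nonneg h2 (by linarith))
    have h9 : (1 - t : ℝ) * (1 - s) * δ ≤ (1 - t) * (1 - s) * 1 :=
      mul_le_mul_of_nonneg_left (hδε.trans h6) (mul_nonneg (by linarith) (by linarith))
    constructor <;> nlinarith
  obtain ⟨Δ, hΔ⟩ := Config.exists_path (card_sum_two hκ)
    (fun t : I => pairFamily (g 0) (g ((1 - t) * ε + t * δ)) r)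
    (continuous_pairFamily (by fun_prop) (by fun_prop) continuous_const)
    (fun t => hg.pairFamily_injective hr (hδ.trans_le (hmem t).1) ((hmem t).2.trans hε.le_one))
    (X := Y) (Y := Y')
    (by rw [← γ.target, hγ, range_pairFamily]; simp)
    (by rw [← γ'.target, hγ', range_pairFamily]; simp)
  have h1 : (Path.Homotopic.Quotient.mk γ).trans (.mk Δ) =
      (Path.Homotopic.Quotient.mk γ').trans (.mk (Path.refl Y')) := by
    refine Config.trans_eq_trans_of_motion (card_sum_two hκ)
      (fun p : I × I => pairFamily (g 0)
        (g ((1 - p.1) * (1 - p.2) + p.1 * (1 - p.2) * ε + p.2 * δ)) r)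
      (continuous_pairFamily (by fun_prop) (by fun_prop) continuous_const)
      (fun p => have h := hmem' p.1 p.2
        hg.pairFamily_injective hr (hδ.trans_le h.1) h.2) _ _ _ _ ?_ ?_ ?_ ?_
    · intro t; rw [hγ, range_pairFamily]; simp; ring_nf
    · intro t; rw [hΔ, range_pairFamily, range_pairFamily]; simp
    · intro t; rw [hγ', range_pairFamily]; simp; ring_nf
    · intro t; rw [Path.refl_apply, ← γ'.target, hγ', range_pairFamily]; simp
  -- The pair is turned while its second point slides from `g ε` to `g δ`. Clearness for all `s ≤
  -- ε`, and not only for `s = ε`, is what makes this possible.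
  have h2 : (Path.Homotopic.Quotient.mk Δ).trans (.mk τ') =
      (Path.Homotopic.Quotient.mk τ).trans (.mk Δ) := by
    refine Config.trans_eq_trans_of_motion (card_sum_two hκ)
      (fun p : I × I => pairFamily (rotPoint (g 0) (g ((1 - p.1) * ε + p.1 * δ)) p.2)
        (rotPoint (g ((1 - p.1) * ε + p.1 * δ)) (g 0) p.2) r)
      (continuous_pairFamily (by fun_prop) (by fun_prop) continuous_const)
      (fun p => hg.pairFamily_rotPoint_injective hr hε (hδ.trans_le (hmem p.1).1)
        (hmem p.1).2 p.2) _ _ _ _ ?_ ?_ ?_ ?_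
    · intro t; rw [hΔ, range_pairFamily, range_pairFamily]; simp [rotPoint_zero]
    · intro t; rw [hτ', range_pairFamily]; simp
    · intro t; rw [hτ, range_pairFamily]; simp
    · intro t; rw [hΔ, range_pairFamily, range_pairFamily]; simp [rotPoint_one, Set.pair_comm]
  rw [Path.Homotopic.Quotient.mk_refl, Path.Homotopic.Quotient.trans_refl] at h1
  have h3 : Path.Homotopic.Quotient.mk τ = (Path.Homotopic.Quotient.mk Δ).trans
      ((Path.Homotopic.Quotient.mk τ').trans (Path.Homotopic.Quotient.mk Δ).symm) := by
    rw [← Path.Homotopic.Quotient.trans_assoc, h2]; simp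
  have h4 : (Path.Homotopic.Quotient.mk Δ).symm.trans (Path.Homotopic.Quotient.mk γ).symm =
      (Path.Homotopic.Quotient.mk γ').symm := by
    calc (Path.Homotopic.Quotient.mk Δ).symm.trans (Path.Homotopic.Quotient.mk γ).symm
      _ = (Path.Homotopic.Quotient.mk γ').symm.trans (((Path.Homotopic.Quotient.mk γ).trans
            (.mk Δ)).trans ((Path.Homotopic.Quotient.mk Δ).symm.trans
              (Path.Homotopic.Quotient.mk γ).symm)) := by
          rw [h1]; simp [← Path.Homotopic.Quotient.trans_assoc]
      _ = (Path.Homotopic.Quotient.mk γ').symm.trans ((Path.Homotopic.Quotient.mk γ).trans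
            (((Path.Homotopic.Quotient.mk Δ).trans (Path.Homotopic.Quotient.mk Δ).symm).trans
              (Path.Homotopic.Quotient.mk γ).symm)) := by
          simp only [Path.Homotopic.Quotient.trans_assoc]
      _ = _ := by simp
  rw [h3, ← h4, ← h1]
  simp only [Path.Homotopic.Quotient.trans_assoc]

/-- A compact family of arcs admits a common admissible `ε`. -/
theorem exists_forall_isClear {r : I → κ → ℂ} (hrc : Continuous r) {H : I → ℝ → ℂ}
    (hHc : Continuous (Function.uncurry H)) (hH : ∀ t, IsArcAvoiding (Set.range (r t)) (H t)) :
    ∃ ε, ∀ t, IsClear (Set.range (r t)) (H t) ε := by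
  have hHc' : ∀ {Z : Type} [TopologicalSpace Z] {a : Z → I} {b : Z → ℝ}, Continuous a →
      Continuous b → Continuous fun z => H (a z) (b z) := fun ha hb => hHc.comp (ha.prodMk hb)
  -- At `s = 0` the disk degenerates to the point `H t 0`, which is not a resting point. The strict
  -- inequality persists for small `s`, uniformly in `t` by compactness of `I`.
  have key : ∀ᶠ s in nhds (0 : ℝ), ∀ t ∈ (Set.univ : Set I), ∀ k,
      dist (H t 0) (H t s) / 2 < dist (r t k) ((H t 0 + H t s) / 2) := by
    refine isCompact_univ.eventually_forall_of_forall_eventually fun t _ => ?_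
    refine Filter.eventually_all.2 fun k => ?_
    have hc0 : Continuous fun z : ℝ × I => H z.2 0 := hHc' continuous_snd continuous_const
    have hc1 : Continuous fun z : ℝ × I => H z.2 z.1 := hHc' continuous_snd continuous_fst
    have hc2 : Continuous fun z : ℝ × I => r z.2 k :=
      ((continuous_apply k).comp hrc).comp continuous_snd
    refine ContinuousAt.eventually_lt (f := fun z : ℝ × I => dist (H z.2 0) (H z.2 z.1) / 2)
      (g := fun z : ℝ × I => dist (r z.2 k) ((H z.2 0 + H z.2 z.1) / 2))
      (by fun_prop) (by fun_prop) ?_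
    simp only [dist_self, zero_div, add_self_div_two, dist_pos]
    exact fun h => (hH t).notMem 0 ⟨le_rfl, zero_le_one⟩ ⟨k, h⟩
  obtain ⟨ε, hε, h⟩ := Metric.eventually_nhds_iff.1 key
  refine ⟨min (ε / 2) 1, fun t => ⟨by positivity, min_le_right _ _, ?_⟩⟩
  rintro s ⟨hs0, hs1⟩ _ ⟨k, rfl⟩
  refine h ?_ t trivial k
  rw [Real.dist_0_eq_abs, abs_of_nonneg hs0]
  have := hs1.trans (min_le_left _ _)
  linarith

end Isotopy

/-- `β` is the positive band along the arc `g`, with rest points `R`. -/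
def IsArcBand {n : ℕ} (R : Set ℂ) (g : ℝ → ℂ) {X : Config n ℂ}
    (β : Path.Homotopic.Quotient X X) : Prop :=
  ∃ ε, IsClear R g ε ∧ IsBand R g ε β

section Isotopy

variable {n : ℕ} {κ : Type*} [Fintype κ]

theorem IsArcAvoiding.exists_isClear {r : κ → ℂ} {g : ℝ → ℂ}
    (hg : IsArcAvoiding (Set.range r) g) : ∃ ε, IsClear (Set.range r) g ε :=
  have ⟨ε, hε⟩ := exists_forall_isClear (r := fun _ => r) continuous_const (H := fun _ => g)
    (hg.continuous.comp continuous_snd) (fun _ => hg)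
  ⟨ε, hε 0⟩

theorem IsArcBand.isBand (hκ : Fintype.card κ + 2 = n) {r : κ → ℂ} (hr : Function.Injective r)
    {g : ℝ → ℂ} (hg : IsArcAvoiding (Set.range r) g) {X : Config n ℂ}
    {β : Path.Homotopic.Quotient X X} (hβ : IsArcBand (Set.range r) g β)
    {ε : ℝ} (hε : IsClear (Set.range r) g ε) : IsBand (Set.range r) g ε β := by
  obtain ⟨δ, hδ, h⟩ := hβ
  have hX : (X.points : Set ℂ) = {g 0, g 1} ∪ Set.range r := by
    obtain ⟨Y, γ, τ, hγ, hτ, rfl⟩ := h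
    rw [← γ.source, hγ]; simp
  obtain ⟨β', hβ'⟩ := exists_isBand_range hκ hr hg hε hX
  rcases le_total δ ε with hle | hle
  · rwa [← IsBand.eq_of_le hκ hr hg hε hδ.pos hle hβ' h]
  · rwa [IsBand.eq_of_le hκ hr hg hδ hε.pos hle h hβ']

theorem IsArcBand.unique (hκ : Fintype.card κ + 2 = n) {r : κ → ℂ} (hr : Function.Injective r)
    {g : ℝ → ℂ} (hg : IsArcAvoiding (Set.range r) g) {X : Config n ℂ}
    {β β' : Path.Homotopic.Quotient X X} (hβ : IsArcBand (Set.range r) g β)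
    (hβ' : IsArcBand (Set.range r) g β') : β = β' := by
  obtain ⟨ε, hε, h⟩ := hβ
  exact IsBand.eq_of_le hκ hr hg hε hε.pos le_rfl h (hβ'.isBand hκ hr hg hε)

theorem exists_isArcBand (hκ : Fintype.card κ + 2 = n) {r : κ → ℂ}
    (hr : Function.Injective r) {g : ℝ → ℂ} (hg : IsArcAvoiding (Set.range r) g) {X : Config n ℂ}
    (hX : (X.points : Set ℂ) = {g 0, g 1} ∪ Set.range r) :
    ∃ β : Path.Homotopic.Quotient X X, IsArcBand (Set.range r) g β := by
  obtain ⟨ε, hε⟩ := hg.exists_isClear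
  obtain ⟨β, hβ⟩ := exists_isBand_range hκ hr hg hε hX
  exact ⟨β, ε, hε, hβ⟩

/-- Bands are carried along by isotopies of the arc and the rest points. -/
theorem IsArcBand.trans_eq (hκ : Fintype.card κ + 2 = n) {r : I → κ → ℂ}
    (hrc : Continuous r) (hr : ∀ t, Function.Injective (r t)) {H : I → ℝ → ℂ}
    (hHc : Continuous (Function.uncurry H)) (hH : ∀ t, IsArcAvoiding (Set.range (r t)) (H t))
    {X Y : Config n ℂ} (Γ : Path X Y)
    (hΓ : ∀ t, ((Γ t).points : Set ℂ) = {H t 0, H t 1} ∪ Set.range (r t))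
    {β : Path.Homotopic.Quotient X X} {β' : Path.Homotopic.Quotient Y Y}
    (hβ : IsArcBand (Set.range (r 0)) (H 0) β) (hβ' : IsArcBand (Set.range (r 1)) (H 1) β') :
    β.trans (.mk Γ) = (Path.Homotopic.Quotient.mk Γ).trans β' := by
  obtain ⟨ε, hε⟩ := exists_forall_isClear hrc hHc hH
  exact IsBand.trans_eq_of_isClear hκ hrc hr hHc hH hε Γ hΓ
    (hβ.isBand hκ (hr 0) (hH 0) (hε 0)) (hβ'.isBand hκ (hr 1) (hH 1) (hε 1))

end Isotopy

/-- The rest points of a configuration containing the endpoints of an arc. -/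
theorem IsArcAvoiding.exists_fintype {n : ℕ} {X : Config n ℂ} {R : Set ℂ} {g : ℝ → ℂ}
    (hg : IsArcAvoiding R g) (hX : (X.points : Set ℂ) = {g 0, g 1} ∪ R) :
    ∃ _ : Fintype R, Fintype.card R + 2 = n := by
  classical
  have hfin : R.Finite := X.points.finite_toSet.subset (hX ▸ Set.subset_union_right)
  refine ⟨hfin.fintype, ?_⟩
  have hdisj : Disjoint ({g 0, g 1} : Set ℂ) R := by
    rw [Set.disjoint_left]
    rintro _ (rfl | rfl)
    · exact hg.notMem 0 (by simp)
    · exact hg.notMem 1 (by simp)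
  rw [← Set.toFinset_card, ← Set.ncard_eq_toFinset_card', ← X.card_points,
    ← Set.ncard_coe_finset, hX, Set.ncard_union_eq hdisj (by simp) hfin,
    Set.ncard_pair (hg.zero_ne one_pos le_rfl), add_comm]

/-! ### The braid group on two strings is infinite cyclic. -/

theorem Config.unorder_surjective {n : ℕ} {T : Type*} :
    Function.Surjective (Config.unorder : OrderedConfig n T → Config n T) := fun X => by
  let e := X.points.equivFinOfCardEq X.card_points
  refine ⟨⟨fun i => (e.symm i : T), Subtype.val_injective.comp e.symm.injective⟩,
    Config.ext (Finset.ext fun z => ?_)⟩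
  rw [Config.mem_points_unorder]
  exact ⟨by rintro ⟨i, rfl⟩; exact (e.symm i).2, fun hz => ⟨e ⟨z, hz⟩, by simp⟩⟩

theorem Config.isQuotientMap_unorder {n : ℕ} {T : Type*} [TopologicalSpace T] :
    Topology.IsQuotientMap (Config.unorder : OrderedConfig n T → Config n T) :=
  ⟨⟨rfl⟩, Config.unorder_surjective⟩

theorem add_exp_ne_sub_exp (m z : ℂ) : m + Complex.exp z ≠ m - Complex.exp z := fun h =>
  Complex.exp_ne_zero z (by linear_combination h / 2)

/-- The universal covering of the space of two-point configurations of the plane. -/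
noncomputable def configTwoCover (p : ℂ × ℂ) : Config 2 ℂ :=
  pairConfig (p.1 + Complex.exp p.2) (p.1 - Complex.exp p.2) (add_exp_ne_sub_exp _ _)

/-- Ordered pairs of distinct points, in terms of their midpoint and half of their difference. -/
noncomputable def orderedConfigTwoHomeomorph : ℂ × {z : ℂ // z ≠ 0} ≃ₜ OrderedConfig 2 ℂ where
  toFun p := orderedPair (p.1 + p.2) (p.1 - p.2) fun h => p.2.2 (by linear_combination h / 2)
  invFun v := ((v.1 0 + v.1 1) / 2, ⟨(v.1 0 - v.1 1) / 2, fun h =>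
    absurd (v.2 (show v.1 0 = v.1 1 by linear_combination 2 * h)) (by decide)⟩)
  left_inv p := by
    ext <;> simp [orderedPair]
  right_inv v := by
    ext i
    fin_cases i <;> simp [orderedPair] <;> ring
  continuous_toFun := by
    refine Continuous.subtype_mk (continuous_pi fun i => ?_) _
    fin_cases i <;> simp <;> fun_prop
  continuous_invFun := by
    have h : ∀ i, Continuous fun v : OrderedConfig 2 ℂ => v.1 i := fun i =>
      (continuous_apply i).comp continuous_subtype_val
    exact ((h 0).add (h 1)).div_const 2 |>.prodMk
      (Continuous.subtype_mk (((h 0).sub (h 1)).div_const 2) _)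

/-- The map is a composite of quotient maps: the exponential on half of the difference, the linear
change to midpoint coordinates, and forgetting the order. -/
theorem isQuotientMap_configTwoCover : Topology.IsQuotientMap configTwoCover := by
  have h1 : IsOpenQuotientMap
      (fun z : ℂ => (⟨_, z.exp_ne_zero⟩ : {z : ℂ // z ≠ 0})) :=
    ⟨fun z => ⟨_, Subtype.ext (Complex.exp_log z.2)⟩, by fun_prop,
      Complex.isCoveringMap_exp.isLocalHomeomorph.isOpenMap⟩
  exact Config.isQuotientMap_unorder.comp (orderedConfigTwoHomeomorph.isQuotientMap.comp
    ((IsOpenQuotientMap.id (X := ℂ)).prodMap h1).isQuotientMap)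

theorem pairConfig_eq_iff {T : Type*} {a b c d : T} {h : a ≠ b} {h' : c ≠ d} :
    pairConfig a b h = pairConfig c d h' ↔ (a = c ∧ b = d) ∨ (a = d ∧ b = c) := by
  constructor
  · intro he
    have ha : a ∈ (pairConfig c d h').points := he ▸ mem_pairConfig.2 (Or.inl rfl)
    have hb : b ∈ (pairConfig c d h').points := he ▸ mem_pairConfig.2 (Or.inr rfl)
    rw [mem_pairConfig] at ha hb
    grind
  · rintro (⟨rfl, rfl⟩ | ⟨rfl, rfl⟩)
    · rfl
    · exact Config.ext (Finset.ext fun z => by rw [mem_pairConfig, mem_pairConfig, or_comm])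

/-- A pair `{m + w, m - w}` determines exactly `m` and `w ^ 2`, and squaring `exp` halves its period
to `π i`. -/
theorem configTwoCover_eq_iff (p q : ℂ × ℂ) : configTwoCover p = configTwoCover q ↔
    ∃ k : ℤ, p = q + k • ((0, Real.pi * Complex.I) : ℂ × ℂ) := by
  have hsq : (∃ k : ℤ, p = q + k • ((0, Real.pi * Complex.I) : ℂ × ℂ)) ↔
      p.1 = q.1 ∧ Complex.exp (2 * p.2) = Complex.exp (2 * q.2) := by
    rw [Complex.exp_eq_exp_iff_exists_int, ← exists_and_left]
    refine exists_congr fun k => ?_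
    rw [Prod.ext_iff]
    simp only [Prod.fst_add, Prod.snd_add, Prod.smul_fst, Prod.smul_snd, smul_zero, add_zero]
    rw [zsmul_eq_mul]
    refine and_congr_right fun _ => ⟨fun h => by rw [h]; ring, fun h => by linear_combination h / 2⟩
  rw [hsq, configTwoCover, configTwoCover, pairConfig_eq_iff, two_mul, two_mul, Complex.exp_add,
    Complex.exp_add, mul_self_eq_mul_self_iff]
  constructor
  · rintro (⟨h1, h2⟩ | ⟨h1, h2⟩)
    · exact ⟨by linear_combination (h1 + h2) / 2, Or.inl (by linear_combination (h1 - h2) / 2)⟩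
    · exact ⟨by linear_combination (h1 + h2) / 2, Or.inr (by linear_combination (h1 - h2) / 2)⟩
  · rintro ⟨h1, h2 | h2⟩
    · exact Or.inl ⟨by rw [h1, h2], by rw [h1, h2]⟩
    · exact Or.inr ⟨by rw [h1, h2]; ring, by rw [h1, h2]; ring⟩

/-- The fibres are the cosets of a discrete subgroup acting by translations, and the map is a
quotient map. -/
theorem isAddQuotientCoveringMap_configTwoCover :
    IsAddQuotientCoveringMap configTwoCover
      (AddSubgroup.zmultiples ((0, Real.pi * Complex.I) : ℂ × ℂ)) := by
  refine isQuotientMap_configTwoCover.isAddQuotientCoveringMap_of_addSubgroup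
    _ ⟨NormedSpace.discreteTopology_zmultiples _⟩ fun {p q} => ?_
  rw [eq_comm, configTwoCover_eq_iff, AddSubgroup.mem_zmultiples_iff]
  exact exists_congr fun k => by rw [eq_comm, eq_add_neg_iff_add_eq, eq_comm, add_comm, eq_comm]

section HalfTwist

variable {a b : ℂ} (h : a ≠ b)

/-- The class of the half twist in the fundamental group of the two-point configurations. -/
noncomputable def halfTwist : FundamentalGroup (Config 2 ℂ) (pairConfig a b h) :=
  FundamentalGroup.fromPath (Path.Homotopic.Quotient.mk (halfTwistPath a b h))

theorem exists_halfTwist_equiv :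
    ∃ φ : FundamentalGroup (Config 2 ℂ) (pairConfig a b h) ≃*
        (Multiplicative (AddSubgroup.zmultiples ((0, Real.pi * Complex.I) : ℂ × ℂ)))ᵐᵒᵖ,
      φ (halfTwist h) = MulOpposite.op (Multiplicative.ofAdd
        ⟨(0, Real.pi * Complex.I), AddSubgroup.mem_zmultiples _⟩) := by
  let m : ℂ := (a + b) / 2
  let z : ℂ := Complex.log ((a - b) / 2)
  have hz : Complex.exp z = (a - b) / 2 :=
    Complex.exp_log (div_ne_zero (sub_ne_zero.2 h) two_ne_zero)
  have hcover : ∀ t : I, configTwoCover (m, z + Real.pi * Complex.I * (t : ℝ)) =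
      halfTwistPath a b h t := fun t => by
    change pairConfig _ _ _ = pairConfig _ _ _
    rw [pairConfig_eq_iff]
    left
    simp only [Complex.exp_add, hz]
    exact ⟨by ring, by ring⟩
  have h0 : configTwoCover (m, z) = pairConfig a b h := by
    have := hcover 0
    simpa using this
  have h1 : configTwoCover (m, z + Real.pi * Complex.I) = pairConfig a b h := by
    have := hcover 1
    simpa using this
  -- The lift of the half twist keeps the midpoint and moves the logarithm straight up by `π i`;
  -- hence its deck transformation is the generator.
  let Γ : Path (m, z) (m, z + Real.pi * Complex.I) :=
    ⟨⟨fun t => (m, z + Real.pi * Complex.I * (t : ℝ)), by fun_prop⟩, by simp, by simp⟩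
  refine ⟨isAddQuotientCoveringMap_configTwoCover.fundamentalGroupEquiv ⟨(m, z), h0⟩, ?_⟩
  refine isAddQuotientCoveringMap_configTwoCover.fundamentalGroupToMulOpposite_apply_eq_Iff.2 ?_
  rw [isAddQuotientCoveringMap_configTwoCover.isCoveringMap.monodromy_eq_of_map_eq
    (ey := ⟨(m, z + Real.pi * Complex.I), h1⟩) (Path.Homotopic.Quotient.mk Γ)]
  · change (((0, Real.pi * Complex.I) : ℂ × ℂ) + (m, z)) = _
    simp [add_comm]
  · refine congrArg Path.Homotopic.Quotient.mk (Path.ext (funext fun t => ?_))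
    exact hcover t

theorem exists_zpow_halfTwist (x : FundamentalGroup (Config 2 ℂ) (pairConfig a b h)) :
    ∃ k : ℤ, halfTwist h ^ k = x := by
  obtain ⟨φ, hφ⟩ := exists_halfTwist_equiv h
  obtain ⟨k, hk⟩ := AddSubgroup.mem_zmultiples_iff.1 (Multiplicative.toAdd (φ x).unop).2
  refine ⟨k, φ.injective ?_⟩
  rw [map_zpow, hφ, ← MulOpposite.op_zpow, ← ofAdd_zsmul]
  refine MulOpposite.unop_injective (Multiplicative.toAdd.injective (Subtype.ext ?_))
  exact hk

theorem halfTwist_zpow_eq_one {k : ℤ} (hk : halfTwist h ^ k = 1) : k = 0 := by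
  obtain ⟨φ, hφ⟩ := exists_halfTwist_equiv h
  have h1 := congrArg φ hk
  rw [map_zpow, hφ, map_one, ← MulOpposite.op_zpow, ← ofAdd_zsmul, ← MulOpposite.op_one,
    MulOpposite.op_inj, ← ofAdd_zero, Multiplicative.ofAdd.injective.eq_iff] at h1
  have h2 : (k : ℂ) * (Real.pi * Complex.I) = 0 := by
    simpa using congrArg (fun p => (Subtype.val p : ℂ × ℂ).2) h1
  simpa [Real.pi_ne_zero] using h2

theorem isCyclic_fundamentalGroup_configTwo (X : Config 2 ℂ) :
    IsCyclic (FundamentalGroup (Config 2 ℂ) X) := by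
  obtain ⟨v, rfl⟩ := Config.unorder_surjective X
  have hv : v.1 0 ≠ v.1 1 := fun h => absurd (v.2 h) (by decide)
  have h1 : Config.unorder v = pairConfig (v.1 0) (v.1 1) hv := by
    refine congrArg Config.unorder (Subtype.ext (funext fun i => ?_))
    fin_cases i <;> rfl
  rw [h1]
  exact ⟨halfTwist hv, exists_zpow_halfTwist hv⟩

end HalfTwist

namespace Config

variable {n : ℕ} {S T : Type*} [TopologicalSpace S] [TopologicalSpace T]

/-- The map of configuration spaces induced by a homeomorphism. -/
noncomputable def mapHomeomorph (φ : S ≃ₜ T) : C(Config n S, Config n T) where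
  toFun X := ⟨X.points.map φ.toEquiv.toEmbedding, by rw [Finset.card_map, X.card_points]⟩
  continuous_toFun := by
    refine continuous_coinduced_dom.2 ?_
    have hc : Continuous fun v : OrderedConfig n S =>
        (⟨φ ∘ v.1, φ.injective.comp v.2⟩ : OrderedConfig n T) :=
      Continuous.subtype_mk (continuous_pi fun i =>
        φ.continuous.comp ((continuous_apply i).comp continuous_subtype_val)) _
    refine (continuous_unorder.comp hc).congr fun v => Config.ext (Finset.ext fun z => ?_)
    change z ∈ (unorder _).points ↔ z ∈ (unorder v).points.map _
    simp only [mem_points_unorder, Finset.mem_map_equiv, Function.comp_apply]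
    exact exists_congr fun i => (φ.toEquiv.eq_symm_apply).symm

theorem mapHomeomorph_symm_apply (φ : S ≃ₜ T) (X : Config n S) :
    mapHomeomorph φ.symm (mapHomeomorph φ X) = X := by
  refine Config.ext ?_
  change (X.points.map _).map _ = _
  rw [Finset.map_map]
  convert Finset.map_refl
  ext z
  simp

/-- A disk inherits cyclicity from the plane. That the generator has infinite order is only needed
in the plane, since it is tested there after inclusion. -/
theorem isCyclic_fundamentalGroup_of_homeomorph (φ : S ≃ₜ ℂ) (X : Config 2 S) :
    IsCyclic (FundamentalGroup (Config 2 S) X) := by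
  have := isCyclic_fundamentalGroup_configTwo (mapHomeomorph φ X)
  refine isCyclic_of_surjective
    (FundamentalGroup.mapOfEq (mapHomeomorph φ.symm) (mapHomeomorph_symm_apply φ X)) fun x => ?_
  refine ⟨FundamentalGroup.map (mapHomeomorph φ) X x, ?_⟩
  rw [FundamentalGroup.mapOfEq_apply]
  obtain ⟨p, rfl⟩ := Path.Homotopic.Quotient.mk_surjective x
  refine congrArg Path.Homotopic.Quotient.mk (Path.ext (funext fun t => ?_))
  exact mapHomeomorph_symm_apply φ (p t)

end Config

/-- If `s = f (g ^ m)` for a generator `g`, and `g ^ k` lies in the kernel, then `s ^ k = f (g ^ k)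
^ m = 1`, which forces `k = 0`. -/
theorem MonoidHom.injective_of_isCyclic {G H : Type*} [Group G] [Group H] [IsCyclic G]
    (f : G →* H) {s : H} (hs : s ∈ f.range) (hinf : ∀ k : ℤ, s ^ k = 1 → k = 0) :
    Function.Injective f := by
  obtain ⟨g, hg⟩ := IsCyclic.exists_generator (α := G)
  obtain ⟨x, rfl⟩ := hs
  obtain ⟨m, rfl⟩ := hg x
  rw [injective_iff_map_eq_one]
  intro y hy
  obtain ⟨k, rfl⟩ := hg y
  have h1 : k = 0 := by
    refine hinf k ?_
    rw [← map_zpow, ← zpow_mul, mul_comm, zpow_mul, map_zpow, hy, one_zpow]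
  rw [h1]
  exact zpow_zero g

/-! ### Tubular neighbourhoods of edges and existence of disks. -/

namespace Edge

/-- The tubular coordinates around an edge. -/
noncomputable def tube (e : Edge) (z : ℂ) : ℂ :=
  e.param z.re + z.im * Complex.I * deriv e.param z.re

theorem contDiff_deriv_param (e : Edge) : ContDiff ℝ ∞ (deriv e.param) :=
  (contDiff_infty_iff_deriv.1 e.contDiff_param).2

theorem contDiff_tube (e : Edge) : ContDiff ℝ ∞ e.tube := by
  have h1 := e.contDiff_param
  have h2 := e.contDiff_deriv_param
  have hre : ContDiff ℝ ∞ (fun z : ℂ => z.re) := Complex.reCLM.contDiff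
  have him : ContDiff ℝ ∞ (fun z : ℂ => (z.im : ℂ)) :=
    Complex.ofRealCLM.contDiff.comp Complex.imCLM.contDiff
  exact (h1.comp hre).add ((him.mul contDiff_const).mul (h2.comp hre))

theorem tube_ofReal (e : Edge) (s : ℝ) : e.tube s = e.param s := by
  simp [tube]

/-- On the real axis the term with the second derivative is multiplied by the imaginary part `0`, so
the differential is multiplication by the velocity, which is invertible for parameters in `[0, 1]`.
-/
theorem hasFDerivAt_tube (e : Edge) (s : ℝ) :
    HasFDerivAt e.tube
      ((ContinuousLinearMap.mul ℝ ℂ (deriv e.param s)) : ℂ →L[ℝ] ℂ) (s : ℂ) := by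
  have h1 : HasDerivAt e.param (deriv e.param s) s :=
    (e.contDiff_param.differentiable (by simp)).differentiableAt.hasDerivAt
  have h2 : HasDerivAt (deriv e.param) (deriv (deriv e.param) s) s :=
    (e.contDiff_deriv_param.differentiable (by simp)).differentiableAt.hasDerivAt
  have hre : HasFDerivAt (fun z : ℂ => z.re) Complex.reCLM (s : ℂ) := Complex.reCLM.hasFDerivAt
  have him : HasFDerivAt (fun z : ℂ => (z.im : ℂ))
      (Complex.ofRealCLM.comp Complex.imCLM) (s : ℂ) :=
    (Complex.ofRealCLM.comp Complex.imCLM).hasFDerivAt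
  have h3 := HasFDerivAt.comp (s : ℂ) (g := e.param) (g' := _) (by simpa using h1.hasFDerivAt) hre
  have h4 := HasFDerivAt.comp (s : ℂ) (g := deriv e.param) (g' := _)
    (by simpa using h2.hasFDerivAt) hre
  have h5 := h3.add ((him.mul_const Complex.I).mul h4)
  refine h5.congr_fderiv ?_
  ext z
  simp
  conv_rhs => rw [← Complex.re_add_im z]
  ring

theorem exists_openPartialHomeomorph_tube (e : Edge) {s : ℝ} (hs : s ∈ Set.Icc (0 : ℝ) 1) :
    ∃ φ : OpenPartialHomeomorph ℂ ℂ, (s : ℂ) ∈ φ.source ∧ (φ : ℂ → ℂ) = e.tube := by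
  let L : ℂ ≃L[ℝ] ℂ := ContinuousLinearEquiv.smulLeft (Units.mk0 _ (e.deriv_param_ne s hs))
  have hL : HasFDerivAt e.tube (L : ℂ →L[ℝ] ℂ) (s : ℂ) :=
    (e.hasFDerivAt_tube s).congr_fderiv (by ext z; rfl)
  exact ⟨e.contDiff_tube.contDiffAt.toOpenPartialHomeomorph e.tube hL (by simp),
    ContDiffAt.mem_toOpenPartialHomeomorph_source _ hL (by simp), rfl⟩

theorem isCompact_ofReal_image_Icc : IsCompact (Complex.ofReal '' Set.Icc (0 : ℝ) 1) :=
  isCompact_Icc.image Complex.continuous_ofReal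

/-- A continuous map that is injective on a compact set and locally injective at each of its points
is injective on a neighbourhood of that set. -/
theorem exists_nhdsSet_injOn_tube (e : Edge) :
    ∃ t ∈ 𝓝ˢ (Complex.ofReal '' Set.Icc (0 : ℝ) 1), Set.InjOn e.tube t := by
  refine Set.InjOn.exists_mem_nhdsSet ?_ isCompact_ofReal_image_Icc
    (fun _ _ => e.contDiff_tube.continuous.continuousAt) ?_
  · rintro _ ⟨s, hs, rfl⟩ _ ⟨t, ht, rfl⟩ h
    rw [tube_ofReal, tube_ofReal] at h
    rw [e.injOn_param hs ht h]
  · rintro _ ⟨s, hs, rfl⟩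
    obtain ⟨φ, hφs, hφ⟩ := e.exists_openPartialHomeomorph_tube hs
    exact ⟨φ.source, φ.open_source.mem_nhds hφs, hφ ▸ φ.injOn⟩

theorem eventually_map_nhds_tube (e : Edge) :
    ∀ᶠ z in 𝓝ˢ (Complex.ofReal '' Set.Icc (0 : ℝ) 1), Filter.map e.tube (𝓝 z) = 𝓝 (e.tube z) := by
  rw [eventually_nhdsSet_iff_forall]
  rintro _ ⟨s, hs, rfl⟩
  obtain ⟨φ, hφs, hφ⟩ := e.exists_openPartialHomeomorph_tube hs
  filter_upwards [φ.open_source.mem_nhds hφs] with z hz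
  rw [← hφ]
  exact φ.map_nhds_eq hz

/-- A bounded convex nonempty open subset of the plane is homeomorphic to the plane. -/
theorem nonempty_homeomorph_of_convex {V : Set ℂ} (hV : Convex ℝ V) (hVo : IsOpen V)
    (hne : V.Nonempty) (hb : Bornology.IsBounded V) : Nonempty (V ≃ₜ ℂ) := by
  obtain ⟨h, h1, -, -⟩ := exists_homeomorph_image_interior_closure_frontier_eq_unitBall hV
    (by rwa [hVo.interior_eq]) hb
  rw [hVo.interior_eq] at h1
  exact ⟨(h.image V).trans ((Homeomorph.setCongr h1).trans Homeomorph.unitBall.symm)⟩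

/-- The disk is the image, under the tubular coordinates, of a thin thickening of the segment `[0,
1]`. The thickening is convex, bounded and open, hence homeomorphic to the plane, and on it the
coordinates form an open embedding that misses the other points of `X`. -/
theorem nonempty_diskNeighborhood {n : ℕ} (X : Config n ℂ) (e : Edge)
    (he : (X.points : Set ℂ) ∩ e.carrier = e.boundary.points) :
    Nonempty (DiskNeighborhood X e) := by
  set K : Set ℂ := Complex.ofReal '' Set.Icc (0 : ℝ) 1 with hK
  have hcont : Continuous e.tube := e.contDiff_tube.continuous
  have hcar : e.tube '' K = e.carrier := by
    rw [hK, Set.image_image, carrier]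
    exact Set.image_congr fun s _ => e.tube_ofReal s
  obtain ⟨t, ht, hinj⟩ := e.exists_nhdsSet_injOn_tube
  have hX : e.tube ⁻¹' ((X.points \ e.boundary.points : Finset ℂ) : Set ℂ)ᶜ ∈ 𝓝ˢ K := by
    refine ((Finset.isClosed _).isOpen_compl.preimage hcont).mem_nhdsSet.2 fun z hz hzX => ?_
    rw [Finset.mem_coe, Finset.mem_sdiff] at hzX
    have h1 : e.tube z ∈ (X.points : Set ℂ) ∩ e.carrier :=
      ⟨hzX.1, hcar ▸ Set.mem_image_of_mem _ hz⟩
    rw [he] at h1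
    exact hzX.2 h1
  obtain ⟨O, hO, hKO, hOsub⟩ := mem_nhdsSet_iff_exists.1
    (Filter.inter_mem (Filter.inter_mem ht e.eventually_map_nhds_tube) hX)
  obtain ⟨δ, hδ, hδO⟩ := isCompact_ofReal_image_Icc.exists_thickening_subset_open hO hKO
  set V : Set ℂ := Metric.thickening δ K with hV
  have hKV : K ⊆ V := Metric.self_subset_thickening hδ K
  have hKconv : Convex ℝ K := (convex_Icc (0 : ℝ) 1).linear_image Complex.ofRealCLM.toLinearMap
  have hVinj : Set.InjOn e.tube V := hinj.mono fun z hz => (hOsub (hδO hz)).1.1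
  have hVopen : IsOpen V := Metric.isOpen_thickening
  have hopen : IsOpenMap (V.domRestrict e.tube) := by
    rw [isOpenMap_iff_nhds_le]
    intro z
    have h1 : Filter.map e.tube (𝓝 (z : ℂ)) = 𝓝 (e.tube z) := (hOsub (hδO z.2)).1.2
    change 𝓝 (e.tube z) ≤ Filter.map (e.tube ∘ Subtype.val) (𝓝 z)
    rw [← h1, ← Filter.map_map, map_nhds_subtype_coe_eq_nhds z.2 (hVopen.mem_nhds z.2)]
  have hemb : Topology.IsOpenEmbedding (V.domRestrict e.tube) :=
    .of_continuous_injective_isOpenMap (hcont.comp continuous_subtype_val)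
      (Set.injOn_iff_injective.1 hVinj) hopen
  obtain ⟨ψ⟩ := nonempty_homeomorph_of_convex (hKconv.thickening δ) hVopen
    (⟨(0 : ℝ), hKV ⟨0, by simp, rfl⟩⟩) isCompact_ofReal_image_Icc.isBounded.thickening
  have hrange : Set.range (V.domRestrict e.tube) = e.tube '' V := Set.range_domRestrict _ _
  have hsub : e.carrier ⊆ e.tube '' V := hcar ▸ Set.image_mono hKV
  refine ⟨⟨e.tube '' V, hrange ▸ hemb.isOpen_range,
    ⟨(Homeomorph.setCongr hrange).symm.trans (hemb.isEmbedding.toHomeomorph.symm.trans ψ)⟩,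
    hsub, Set.Subset.antisymm ?_ ?_⟩⟩
  · rintro _ ⟨hzX, z, hz, rfl⟩
    by_contra hzb
    exact (hOsub (hδO hz)).2 (Finset.mem_coe.2 (Finset.mem_sdiff.2 ⟨hzX, hzb⟩))
  · rw [← he]
    exact Set.inter_subset_inter_right _ hsub

end Edge

/-! ### Positive bands are bands along arcs; existence and uniqueness. -/

/-- One of the two parametrizations of an edge as an arc. -/
structure Edge.IsParam (e : Edge) (g : ℝ → ℂ) : Prop where
  continuous : Continuous g
  injOn : Set.InjOn g (Set.Icc 0 1)
  image_eq : g '' Set.Icc 0 1 = e.carrier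
  pair_eq : (e.boundary.points : Set ℂ) = {g 0, g 1}

theorem Edge.coe_points_boundary (e : Edge) :
    (e.boundary.points : Set ℂ) = {e.param 0, e.param 1} := by
  ext z
  exact mem_pairConfig

theorem Edge.isParam_param (e : Edge) : e.IsParam e.param :=
  ⟨e.contDiff_param.continuous, e.injOn_param, rfl, e.coe_points_boundary⟩

theorem Edge.isParam_reverse (e : Edge) : e.IsParam fun s => e.param (1 - s) := by
  refine ⟨e.contDiff_param.continuous.comp (by fun_prop), fun s hs t ht h => ?_, ?_, ?_⟩
  · have := e.injOn_param (x₁ := 1 - s) (x₂ := 1 - t) ⟨by linarith [hs.2], by linarith [hs.1]⟩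
      ⟨by linarith [ht.2], by linarith [ht.1]⟩ h
    linarith
  · rw [← Set.image_image e.param, Set.image_const_sub_Icc, Edge.carrier]
    simp
  · rw [e.coe_points_boundary, Set.pair_comm]; simp

theorem Path.Homotopic.Quotient.mk_trans_trans_symm {Y : Type*} [TopologicalSpace Y] {a b : Y}
    (γ : Path a b) (τ : Path b b) : (Quotient.mk γ).trans ((Quotient.mk τ).trans
      (Quotient.mk γ).symm) = Quotient.mk (γ.trans (τ.trans γ.symm)) := rfl

namespace DiskNeighborhood

variable {n : ℕ} {X : Config n ℂ} {e : Edge} {g : ℝ → ℂ}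

theorem mem_points_includeConfig (N : DiskNeighborhood X e) (S : Config 2 N.U) :
    ((includeConfig 2 N.U S).points : Set ℂ) = Subtype.val '' (S.points : Set N.U) := by
  ext z
  exact mem_includeConfigFun

theorem mem_points_extend (N : DiskNeighborhood X e) (S : Config 2 N.U) :
    ((N.extend S).points : Set ℂ) = Subtype.val '' (S.points : Set N.U) ∪
      ((X.points : Set ℂ) \ e.boundary.points) := by
  rw [← N.mem_points_includeConfig]
  change (((includeConfig 2 N.U S).points ∪ (X.points \ e.boundary.points) : Finset ℂ) : Set ℂ) = _
  push_cast
  rfl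

/-- A two-string braid in a disk neighborhood that induces the bands along the edge, both in the
space of two-point configurations and in the space of `n`-point configurations. -/
theorem exists_isArcBand (N : DiskNeighborhood X e) (hg : e.IsParam g) :
    ∃ x : FundamentalGroup (Config 2 N.U) N.base,
      IsArcBand ∅ g (FundamentalGroup.mapOfEq (includeConfig 2 N.U) N.includeConfig_base x) ∧
      IsArcBand ((X.points : Set ℂ) \ e.boundary.points) g
        (FundamentalGroup.mapOfEq N.extend N.extend_base x) := by
  have hgc := hg.continuous
  have hgU : ∀ s ∈ Set.Icc (0 : ℝ) 1, g s ∈ N.U := fun s hs =>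
    N.carrier_subset (hg.image_eq ▸ Set.mem_image_of_mem g hs)
  have hI0 : (0 : ℝ) ∈ Set.Icc (0 : ℝ) 1 := by simp
  have hI1 : (1 : ℝ) ∈ Set.Icc (0 : ℝ) 1 := by simp
  obtain ⟨ρ, hρ, hball⟩ := Metric.isOpen_iff.1 N.isOpen (g 0) (hgU 0 hI0)
  obtain ⟨δ, hδ, hδball⟩ := Metric.continuous_iff.1 hgc 0 ρ hρ
  -- So small that all disks with diameters `[g 0, g s]`, `s ≤ ε`, lie in a ball about `g 0`
  -- contained in `U`. The turn then takes place inside `U`.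
  let ε := min (δ / 2) 1
  have hε0 : 0 < ε := by positivity
  have hε1 : ε ≤ 1 := min_le_right _ _
  have hεδ : ε < δ := (min_le_left _ _).trans_lt (half_lt_self hδ)
  have hdist : ∀ s ∈ Set.Icc 0 ε, dist (g s) (g 0) < ρ := fun s hs => hδball s (by
    rw [Real.dist_0_eq_abs, abs_of_nonneg hs.1]; exact hs.2.trans_lt hεδ)
  have hdisk : ∀ s ∈ Set.Icc 0 ε, ∀ z, dist z ((g 0 + g s) / 2) ≤ dist (g 0) (g s) / 2 →
      z ∈ N.U := fun s hs z hz => hball (by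
    have h1 : dist ((g 0 + g s) / 2) (g 0) = dist (g 0) (g s) / 2 := by
      rw [dist_eq_norm, show (g 0 + g s) / 2 - g 0 = (g s - g 0) / 2 by ring, norm_div,
        ← dist_eq_norm, dist_comm]
      simp
    have h2 := hdist s hs
    rw [dist_comm] at h2
    rw [Metric.mem_ball]
    linarith [dist_triangle z ((g 0 + g s) / 2) (g 0)])
  have hεmem : ε ∈ Set.Icc 0 ε := ⟨hε0.le, le_rfl⟩
  have hrot : ∀ t, rotPoint (g 0) (g ε) t ∈ N.U := fun t =>
    hdisk ε hεmem _ (dist_rotPoint _ _ _).le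
  have hrot' : ∀ t, rotPoint (g ε) (g 0) t ∈ N.U := fun t =>
    hdisk ε hεmem _ (by rw [add_comm, dist_comm (g 0)]; exact (dist_rotPoint _ _ _).le)
  have hne : ∀ s : ℝ, 0 < s → s ≤ 1 → g 0 ≠ g s := fun s h0 h1 h =>
    h0.ne (hg.injOn hI0 ⟨h0.le, h1⟩ h)
  have hmem : ∀ t : I, (1 - t * (1 - ε) : ℝ) ∈ Set.Icc 0 1 := fun t =>
    ⟨hε0.le.trans (one_sub_mul_mem hε1 t).1, (one_sub_mul_mem hε1 t).2⟩
  have hempty : Function.Injective (Empty.elim : Empty → N.U) := fun x => x.elim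
  have hrange : Set.range (Empty.elim : Empty → N.U) = ∅ := Set.range_eq_empty _
  have hcard : Fintype.card (Fin 2 ⊕ Empty) = 2 := by simp
  have hbase : (N.base.points : Set N.U) = {⟨g 0, hgU 0 hI0⟩, ⟨g 1, hgU 1 hI1⟩} := by
    have h1 : Subtype.val '' (N.base.points : Set N.U) = {g 0, g 1} := by
      rw [← N.mem_points_includeConfig, N.includeConfig_base, hg.pair_eq]
    refine Subtype.val_injective.image_injective ?_
    rw [h1, Set.image_pair]
  obtain ⟨F, hF⟩ := Config.exists_map hcard
    (fun t : I => pairFamily (⟨g 0, hgU 0 hI0⟩ : N.U) ⟨g (1 - t * (1 - ε)), hgU _ (hmem t)⟩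
      Empty.elim)
    (continuous_pairFamily continuous_const (Continuous.subtype_mk (by fun_prop) _)
      continuous_const)
    (fun t => pairFamily_injective (fun h => hne _ (hε0.trans_le (one_sub_mul_mem hε1 t).1)
      (hmem t).2 (congrArg Subtype.val h)) hempty (by simp) (by simp))
  let γ : Path N.base (F 1) := ⟨F, Config.ext_coe (by
    change ((F 0).points : Set N.U) = _
    rw [hF, hbase, range_pairFamily, hrange]; simp), rfl⟩
  obtain ⟨τ, hτ⟩ := Config.exists_path hcard
    (fun t : I => pairFamily (⟨rotPoint (g 0) (g ε) t, hrot t⟩ : N.U)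
      ⟨rotPoint (g ε) (g 0) t, hrot' t⟩ Empty.elim)
    (continuous_pairFamily (Continuous.subtype_mk (by fun_prop) _)
      (Continuous.subtype_mk (by fun_prop) _) continuous_const)
    (fun t => pairFamily_injective (fun h => rotPoint_ne (hne ε hε0 hε1) t
      (congrArg Subtype.val h)) hempty (by simp) (by simp)) (X := F 1) (Y := F 1)
    (by rw [hF, range_pairFamily, range_pairFamily, hrange]; simp [rotPoint_zero])
    (by rw [hF, range_pairFamily, range_pairFamily, hrange]; simp [rotPoint_one]
        exact Set.pair_comm _ _)
  have hγ' : ∀ t : I, Subtype.val '' ((γ t).points : Set N.U) = {g 0, g (1 - t * (1 - ε))} :=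
    fun t => by
    rw [show γ t = F t from rfl, hF, range_pairFamily, hrange]
    simp [Set.image_pair]
  have hτ' : ∀ t : I, Subtype.val '' ((τ t).points : Set N.U) =
      {rotPoint (g 0) (g ε) t, rotPoint (g ε) (g 0) t} := fun t => by
    rw [hτ, range_pairFamily, hrange]
    simp [Set.image_pair]
  refine ⟨FundamentalGroup.fromPath (.mk (γ.trans (τ.trans γ.symm))), ⟨ε, ⟨hε0, hε1, by simp⟩,
    ?_⟩, ⟨ε, ⟨hε0, hε1, fun s hs z hz => ?_⟩, ?_⟩⟩
  · refine ⟨includeConfig 2 N.U (F 1),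
      (γ.map (includeConfig 2 N.U).continuous).cast N.includeConfig_base.symm rfl,
      τ.map (includeConfig 2 N.U).continuous, fun t => ?_, fun t => ?_, ?_⟩
    · rw [Set.union_empty, ← hγ', ← N.mem_points_includeConfig]; rfl
    · rw [Set.union_empty, ← hτ', ← N.mem_points_includeConfig]; rfl
    · rw [FundamentalGroup.mapOfEq_apply, Path.Homotopic.Quotient.mk_trans_trans_symm]
      refine congrArg Path.Homotopic.Quotient.mk (Path.ext (funext fun t => ?_))
      simp [Path.trans_apply]
  -- The disks lie in `U`, whereas the remaining points of `X` lie outside of `U`.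
  · by_contra h
    refine N.remaining_notMem z ?_ (hdisk s hs z (not_lt.1 h))
    simpa using hz
  · refine ⟨N.extend (F 1), (γ.map N.extend.continuous).cast N.extend_base.symm rfl,
      τ.map N.extend.continuous, fun t => ?_, fun t => ?_, ?_⟩
    · rw [← hγ', ← N.mem_points_extend]; rfl
    · rw [← hτ', ← N.mem_points_extend]; rfl
    · rw [FundamentalGroup.mapOfEq_apply, Path.Homotopic.Quotient.mk_trans_trans_symm]
      refine congrArg Path.Homotopic.Quotient.mk (Path.ext (funext fun t => ?_))
      simp [Path.trans_apply]

end DiskNeighborhood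

theorem Edge.IsParam.pair_cases {e : Edge} {g : ℝ → ℂ} (hg : e.IsParam g) :
    (g 0 = e.param 0 ∧ g 1 = e.param 1) ∨ (g 0 = e.param 1 ∧ g 1 = e.param 0) :=
  Set.pair_eq_pair_iff.1 (hg.pair_eq.symm.trans e.coe_points_boundary)

/-- The preferred generator is the band along either parametrization of the edge. -/
theorem Edge.IsParam.isArcBand_generator {e : Edge} {g : ℝ → ℂ} (hg : e.IsParam g) :
    IsArcBand ∅ g e.generator := by
  have hrot : ∀ t : ℝ, rotPoint (e.param 1) (e.param 0) t = (e.param 0 + e.param 1) / 2 -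
      Complex.exp (Real.pi * Complex.I * t) * ((e.param 0 - e.param 1) / 2) := fun t => by
    unfold rotPoint; ring
  -- Without resting points `ε = 1` is admissible, so nothing has to be contracted. The turn treats
  -- the endpoints symmetrically as a set, which is why both parametrizations give the same loop.
  refine ⟨1, ⟨one_pos, le_rfl, by simp⟩, e.boundary, Path.refl _,
    halfTwistPath _ _ e.endpoints_ne, fun t => ?_, fun t => ?_, ?_⟩
  · rw [Path.refl_apply, hg.pair_eq]; simp
  · have h1 : ((halfTwistPath _ _ e.endpoints_ne t).points : Set ℂ) =
        {rotPoint (e.param 0) (e.param 1) t, rotPoint (e.param 1) (e.param 0) t} := by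
      ext z
      rw [hrot]
      exact mem_pairConfig
    refine h1.trans ?_
    rw [Set.union_empty]
    rcases hg.pair_cases with ⟨h2, h3⟩ | ⟨h2, h3⟩
    · rw [h2, h3]
    · rw [h2, h3, Set.pair_comm]
  · rw [← Path.Homotopic.Quotient.mk_symm, Path.refl_symm, Path.Homotopic.Quotient.mk_refl,
      Path.Homotopic.Quotient.refl_trans, Path.Homotopic.Quotient.trans_refl]
    rfl

theorem Edge.IsParam.isArcAvoiding {e : Edge} {g : ℝ → ℂ} (hg : e.IsParam g) {R : Set ℂ}
    (hR : Disjoint e.carrier R) : IsArcAvoiding R g :=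
  ⟨hg.continuous, hg.injOn, fun _ hs =>
    Set.disjoint_left.1 hR (hg.image_eq ▸ Set.mem_image_of_mem g hs)⟩

theorem IsArcBand.unique_of_isArcAvoiding {n : ℕ} {X : Config n ℂ} {R : Set ℂ} {g : ℝ → ℂ}
    (hg : IsArcAvoiding R g) (hX : (X.points : Set ℂ) = {g 0, g 1} ∪ R)
    {β β' : Path.Homotopic.Quotient X X} (hβ : IsArcBand R g β) (hβ' : IsArcBand R g β') :
    β = β' := by
  obtain ⟨_, hcard⟩ := hg.exists_fintype hX
  have hrange : Set.range (Subtype.val : R → ℂ) = R := Subtype.range_coe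
  rw [← hrange] at hβ hβ'
  exact hβ.unique hcard Subtype.val_injective (hrange.symm ▸ hg) hβ'

section PositiveBand

variable {n : ℕ} {X : Config n ℂ} {e : Edge}

theorem DiskNeighborhood.mapOfEq_eq_generator (N : DiskNeighborhood X e) {g : ℝ → ℂ}
    (hg : e.IsParam g) {x : FundamentalGroup (Config 2 N.U) N.base}
    (hx : IsArcBand ∅ g
      (FundamentalGroup.mapOfEq (includeConfig 2 N.U) N.includeConfig_base x)) :
    FundamentalGroup.mapOfEq (includeConfig 2 N.U) N.includeConfig_base x = e.generator :=
  hx.unique_of_isArcAvoiding (hg.isArcAvoiding (by simp))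
    (by rw [hg.pair_eq, Set.union_empty]) hg.isArcBand_generator

/-- The small loop `x` in the disk maps to the generator in one space and to the band in the other,
and the defining equation of `ι` relates these two images. The conclusion mentions neither the disk
nor `ι`, so uniqueness of positive bands follows. -/
theorem IsPositiveBand.isArcBand {β : BraidGroup X} (hβ : IsPositiveBand X e β) {g : ℝ → ℂ}
    (hg : e.IsParam g) : IsArcBand ((X.points : Set ℂ) \ e.boundary.points) g β := by
  obtain ⟨ι, ⟨N, hN⟩, rfl⟩ := hβ
  obtain ⟨x, hx1, hx2⟩ := N.exists_isArcBand hg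
  rw [← N.mapOfEq_eq_generator hg hx1]
  rw [← hN] at hx2
  exact hx2

/-- For the chosen disk, the map to `B_{∂e}` is injective because its source is cyclic and its image
contains an element of infinite order; it is surjective because that element generates. The natural
injection is the inverse followed by adding the remaining points. -/
theorem exists_isPositiveBand (he : (X.points : Set ℂ) ∩ e.carrier = e.boundary.points) :
    ∃ β : BraidGroup X, IsPositiveBand X e β := by
  obtain ⟨N⟩ := e.nonempty_diskNeighborhood X he
  obtain ⟨x, hx, -⟩ := N.exists_isArcBand e.isParam_param
  have hgen := N.mapOfEq_eq_generator e.isParam_param hx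
  obtain ⟨φ⟩ := N.isDisk
  have := Config.isCyclic_fundamentalGroup_of_homeomorph φ N.base
  have hinj : Function.Injective
      (FundamentalGroup.mapOfEq (includeConfig 2 N.U) N.includeConfig_base) :=
    MonoidHom.injective_of_isCyclic _ ⟨x, hgen⟩
      (fun _ hk => halfTwist_zpow_eq_one e.endpoints_ne hk)
  have hsurj : Function.Surjective
      (FundamentalGroup.mapOfEq (includeConfig 2 N.U) N.includeConfig_base) := fun y => by
    obtain ⟨k, hk⟩ := exists_zpow_halfTwist e.endpoints_ne y
    exact ⟨x ^ k, by rw [map_zpow, hgen]; exact hk⟩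
  let ψ := MulEquiv.ofBijective _ ⟨hinj, hsurj⟩
  refine ⟨_, (FundamentalGroup.mapOfEq N.extend N.extend_base).comp ψ.symm.toMonoidHom,
    ⟨N, ?_⟩, rfl⟩
  ext y
  exact congrArg (FundamentalGroup.mapOfEq N.extend N.extend_base) (ψ.symm_apply_apply y)

theorem coe_points_eq_of_isParam (he : (X.points : Set ℂ) ∩ e.carrier = e.boundary.points)
    {g : ℝ → ℂ} (hg : e.IsParam g) :
    (X.points : Set ℂ) = {g 0, g 1} ∪ ((X.points : Set ℂ) \ e.boundary.points) := by
  rw [← hg.pair_eq, Set.union_sdiff_cancel]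
  rw [← he]
  exact Set.inter_subset_left

theorem disjoint_carrier_diff (he : (X.points : Set ℂ) ∩ e.carrier = e.boundary.points) :
    Disjoint e.carrier ((X.points : Set ℂ) \ e.boundary.points) := by
  rw [← he, Set.disjoint_left]
  exact fun z hz h => h.2 ⟨h.1, hz⟩

theorem existsUnique_isPositiveBand
    (he : (X.points : Set ℂ) ∩ e.carrier = e.boundary.points) :
    ∃! β : BraidGroup X, IsPositiveBand X e β := by
  obtain ⟨β, hβ⟩ := exists_isPositiveBand he
  refine ⟨β, hβ, fun β' hβ' => ?_⟩
  exact (hβ'.isArcBand e.isParam_param).unique_of_isArcAvoiding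
    (e.isParam_param.isArcAvoiding (disjoint_carrier_diff he))
    (coe_points_eq_of_isParam he e.isParam_param) (hβ.isArcBand e.isParam_param)

end PositiveBand

/-! ### Bands along disjoint arcs commute. -/

theorem Config.card_eq_of_range_eq {n : ℕ} {T ι : Type*} [Fintype ι] {X : Config n T} {w : ι → T}
    (hw : Function.Injective w) (hX : (X.points : Set T) = Set.range w) :
    Fintype.card ι = n := by
  rw [← X.card_points, ← Set.ncard_coe_finset, hX, ← Set.image_univ,
    Set.ncard_image_of_injective _ hw, Set.ncard_univ, Nat.card_eq_fintype_card]

theorem IsClear.subset {R S : Set ℂ} {g : ℝ → ℂ} {ε : ℝ} (h : IsClear R g ε) (hS : S ⊆ R) :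
    IsClear S g ε :=
  ⟨h.pos, h.le_one, fun s hs z hz => h.lt_dist s hs z (hS hz)⟩

/-- The obstacle may be infinite here, because in the commutation argument an entire arc has to be
avoided. -/
theorem IsArcAvoiding.exists_isClear_of_isCompact {K : Set ℂ} (hK : IsCompact K) {g : ℝ → ℂ}
    (hg : IsArcAvoiding K g) : ∃ ε, IsClear K g ε := by
  have hgc := hg.continuous
  have key : ∀ᶠ s in 𝓝 (0 : ℝ), ∀ z ∈ K, dist (g 0) (g s) / 2 < dist z ((g 0 + g s) / 2) := by
    refine hK.eventually_forall_of_forall_eventually fun z hz => ?_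
    refine ContinuousAt.eventually_lt (f := fun p : ℝ × ℂ => dist (g 0) (g p.1) / 2)
      (g := fun p : ℝ × ℂ => dist p.2 ((g 0 + g p.1) / 2)) (by fun_prop) (by fun_prop) ?_
    simp only [dist_self, zero_div, add_self_div_two, dist_pos]
    exact fun h => hg.notMem 0 ⟨le_rfl, zero_le_one⟩ (h ▸ hz)
  obtain ⟨ε, hε, h⟩ := Metric.eventually_nhds_iff.1 key
  refine ⟨min (ε / 2) 1, by positivity, min_le_right _ _, fun s hs => h ?_⟩
  rw [Real.dist_0_eq_abs, abs_of_nonneg hs.1]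
  have := hs.2.trans (min_le_left _ _)
  linarith

theorem IsArcBand.isBand_of_isArcAvoiding {n : ℕ} {X : Config n ℂ} {R : Set ℂ} {g : ℝ → ℂ}
    (hg : IsArcAvoiding R g) (hX : (X.points : Set ℂ) = {g 0, g 1} ∪ R)
    {β : Path.Homotopic.Quotient X X} (hβ : IsArcBand R g β) {ε : ℝ} (hε : IsClear R g ε) :
    IsBand R g ε β := by
  obtain ⟨_, hcard⟩ := hg.exists_fintype hX
  have hrange : Set.range (Subtype.val : R → ℂ) = R := Subtype.range_coe
  rw [← hrange] at hβ hε ⊢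
  exact hβ.isBand hcard Subtype.val_injective (hrange.symm ▸ hg) hε

/-- Bands along disjoint arcs commute. -/
theorem IsArcBand.trans_comm {n : ℕ} {X : Config n ℂ} {R : Set ℂ} {g h : ℝ → ℂ}
    (hg : IsArcAvoiding R g) (hh : IsArcAvoiding R h)
    (hdisj : Disjoint (g '' Set.Icc 0 1) (h '' Set.Icc 0 1))
    (hX : (X.points : Set ℂ) = {g 0, g 1} ∪ ({h 0, h 1} ∪ R))
    {β β' : Path.Homotopic.Quotient X X} (hβ : IsArcBand ({h 0, h 1} ∪ R) g β)
    (hβ' : IsArcBand ({g 0, g 1} ∪ R) h β') : β.trans β' = β'.trans β := by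
  have hI0 : (0 : ℝ) ∈ Set.Icc (0 : ℝ) 1 := by simp
  have hI1 : (1 : ℝ) ∈ Set.Icc (0 : ℝ) 1 := by simp
  have hRfin : R.Finite := X.points.finite_toSet.subset (by
    rw [hX]; exact Set.subset_union_right.trans Set.subset_union_right)
  have := hRfin.fintype
  have hrange : Set.range (Subtype.val : R → ℂ) = R := Subtype.range_coe
  have hhg : ∀ s ∈ Set.Icc (0 : ℝ) 1, h s ∉ g '' Set.Icc 0 1 := fun s hs hmem =>
    Set.disjoint_left.1 hdisj hmem (Set.mem_image_of_mem h hs)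
  -- The obstacle contains all of the arc `g`, not only its endpoints: the endpoints of `h` must
  -- contract and turn without touching `g`.
  have hKcomp : IsCompact (g '' Set.Icc 0 1 ∪ R) :=
    (isCompact_Icc.image hg.continuous).union hRfin.isCompact
  have hhK : IsArcAvoiding (g '' Set.Icc 0 1 ∪ R) h :=
    ⟨hh.continuous, hh.injOn, fun s hs hmem => hmem.elim (hhg s hs) (hh.notMem s hs)⟩
  obtain ⟨ε, hε⟩ := hhK.exists_isClear_of_isCompact hKcomp
  have hsub : ({g 0, g 1} ∪ R : Set ℂ) ⊆ g '' Set.Icc 0 1 ∪ R :=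
    Set.union_subset_union_left _ (Set.pair_subset (Set.mem_image_of_mem g hI0)
      (Set.mem_image_of_mem g hI1))
  have hh' : IsArcAvoiding ({g 0, g 1} ∪ R) h :=
    ⟨hh.continuous, hh.injOn, fun s hs hmem => hhK.notMem s hs (hsub hmem)⟩
  obtain ⟨Y, γ, τ, hγ, hτ, rfl⟩ := hβ'.isBand_of_isArcAvoiding hh'
    (by rw [hX, Set.union_left_comm]) (hε.subset hsub)
  have hhc := hh.continuous
  have hhR : IsArcAvoiding (Set.range (Subtype.val : R → ℂ)) h := hrange.symm ▸ hh
  have hεR : IsClear (Set.range (Subtype.val : R → ℂ)) h ε :=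
    hrange.symm ▸ hε.subset Set.subset_union_right
  have hmem := one_sub_mul_mem hε.le_one
  have hav : ∀ p q : ℂ, p ∉ g '' Set.Icc 0 1 → q ∉ g '' Set.Icc 0 1 →
      IsArcAvoiding (Set.range (pairFamily p q (Subtype.val : R → ℂ))) g := fun p q hp hq => by
    rw [range_pairFamily, hrange]
    refine ⟨hg.continuous, hg.injOn, fun s hs hmem => ?_⟩
    rcases hmem with (rfl | rfl) | hmem
    · exact hp (Set.mem_image_of_mem g hs)
    · exact hq (Set.mem_image_of_mem g hs)
    · exact hg.notMem s hs hmem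
  have hinj : ∀ s, 0 < s → s ≤ 1 →
      Function.Injective (pairFamily (h 0) (h s) (Subtype.val : R → ℂ)) := fun s h0 h1 =>
    hhR.pairFamily_injective Subtype.val_injective h0 h1
  have hcard : Fintype.card (Fin 2 ⊕ R) + 2 = n := by
    rw [← Config.card_eq_of_range_eq (X := X)
      (w := pairFamily (g 0) (g 1) (pairFamily (h 0) (h 1) (Subtype.val : R → ℂ))) ?_ ?_]
    · simp; omega
    · have := hav (h 0) (h 1) (hhg 0 hI0) (hhg 1 hI1)
      exact this.pairFamily_injective (hinj 1 one_pos le_rfl) one_pos le_rfl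
    · rw [range_pairFamily, range_pairFamily, hrange, hX]
  have hcc : Continuous (Function.uncurry fun _ : I => g) := hg.continuous.comp continuous_snd
  have hε1 : ε ∈ Set.Icc (0 : ℝ) 1 := ⟨hε.pos.le, hε.le_one⟩
  have hεmem : ε ∈ Set.Icc 0 ε := ⟨hε.pos.le, le_rfl⟩
  obtain ⟨α, hα⟩ := exists_isArcBand hcard (hinj ε hε.pos hε.le_one)
    (hav (h 0) (h ε) (hhg 0 hI0) (hhg ε hε1)) (X := Y) (by
      rw [← γ.target, hγ, range_pairFamily, hrange, Set.union_left_comm]; simp)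
  -- The arc `g` stands still while two of the resting points move along `h`; the constant isotopy
  -- of `g` carries its band along. The same principle is used for the turn `τ` below.
  have h1 : β.trans (.mk γ) = (Path.Homotopic.Quotient.mk γ).trans α := by
    refine IsArcBand.trans_eq hcard
      (r := fun t => pairFamily (h 0) (h (1 - t * (1 - ε))) (Subtype.val : R → ℂ))
      (continuous_pairFamily (by fun_prop) (by fun_prop) continuous_const)
      (fun t => hinj _ (hε.pos.trans_le (hmem t).1) (hmem t).2)
      (H := fun _ => g) hcc
      (fun t => hav _ _ (hhg _ hI0) (hhg _ ⟨hε.pos.le.trans (hmem t).1, (hmem t).2⟩)) γ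
      (fun t => ?_) ?_ ?_
    · rw [hγ, range_pairFamily, hrange, Set.union_left_comm]
    · rw [range_pairFamily, hrange]; simpa using hβ
    · simpa using hα
  have h2 : α.trans (.mk τ) = (Path.Homotopic.Quotient.mk τ).trans α := by
    refine IsArcBand.trans_eq hcard
      (r := fun t => pairFamily (rotPoint (h 0) (h ε) t) (rotPoint (h ε) (h 0) t)
        (Subtype.val : R → ℂ))
      (continuous_pairFamily (by fun_prop) (by fun_prop) continuous_const)
      (fun t => hhR.pairFamily_rotPoint_injective Subtype.val_injective hεR hε.pos le_rfl t)
      (H := fun _ => g) hcc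
      (fun t => hav _ _ (fun hm => hε.rotPoint_notMem hεmem t (Or.inl hm))
        (fun hm => hε.rotPoint_notMem' hεmem t (Or.inl hm))) τ (fun t => ?_) ?_ ?_
    · rw [hτ, range_pairFamily, hrange, Set.union_left_comm]
    · simpa [rotPoint_zero] using hα
    · rw [range_pairFamily] at hα ⊢
      simpa [rotPoint_one, Set.pair_comm] using hα
  have h3 : α.trans (Path.Homotopic.Quotient.mk γ).symm =
      (Path.Homotopic.Quotient.mk γ).symm.trans β := by
    calc α.trans (Path.Homotopic.Quotient.mk γ).symm
      _ = (Path.Homotopic.Quotient.mk γ).symm.trans (((Path.Homotopic.Quotient.mk γ).trans α).trans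
            (Path.Homotopic.Quotient.mk γ).symm) := by
          simp [← Path.Homotopic.Quotient.trans_assoc]
      _ = _ := by rw [← h1]; simp
  simp only [Path.Homotopic.Quotient.trans_assoc]
  rw [← h3, ← Path.Homotopic.Quotient.trans_assoc β, h1, Path.Homotopic.Quotient.trans_assoc,
    ← Path.Homotopic.Quotient.trans_assoc α, h2, Path.Homotopic.Quotient.trans_assoc]

/-! ### Three moving points and isotopy invariance of the braid relation. -/

theorem exists_isArcBand_of_isArcAvoiding {n : ℕ} {X : Config n ℂ} {R : Set ℂ} {g : ℝ → ℂ}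
    (hg : IsArcAvoiding R g) (hX : (X.points : Set ℂ) = {g 0, g 1} ∪ R) :
    ∃ β : Path.Homotopic.Quotient X X, IsArcBand R g β := by
  obtain ⟨_, hcard⟩ := hg.exists_fintype hX
  have hrange : Set.range (Subtype.val : R → ℂ) = R := Subtype.range_coe
  rw [← hrange] at hX hg ⊢
  exact exists_isArcBand hcard Subtype.val_injective hg hX

/-- The family consisting of `a` and the family `r`. -/
def singleFamily {T κ : Type*} (a : T) (r : κ → T) : Unit ⊕ κ → T := Sum.elim (fun _ => a) r

theorem range_singleFamily {T κ : Type*} (a : T) (r : κ → T) :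
    Set.range (singleFamily a r) = {a} ∪ Set.range r := by
  rw [singleFamily, Set.Sum.elim_range, Set.range_const]

theorem continuous_singleFamily {Y T κ : Type*} [TopologicalSpace T] [TopologicalSpace Y]
    {a : Y → T} {r : Y → κ → T} (ha : Continuous a) (hr : Continuous r) :
    Continuous fun y => singleFamily (a y) (r y) :=
  continuous_pi fun i => i.rec (fun _ => ha) (fun k => (continuous_apply k).comp hr)

theorem singleFamily_injective {T κ : Type*} {a : T} {r : κ → T} (hr : Function.Injective r)
    (ha : a ∉ Set.range r) : Function.Injective (singleFamily a r) :=
  Function.Injective.sumElim (fun _ _ _ => rfl) hr fun _ k h => ha ⟨k, h.symm⟩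

/-- Bands are carried along by isotopies of the arc during which one of the rest points moves. -/
theorem IsArcBand.trans_eq_of_moving_point {n : ℕ} {X Y : Config n ℂ} {R : Set ℂ} {H : I → ℝ → ℂ}
    (hHc : Continuous (Function.uncurry H)) {p : I → ℂ} (hp : Continuous p)
    (hpR : ∀ t, p t ∉ R) (hH : ∀ t, IsArcAvoiding ({p t} ∪ R) (H t)) (Γ : Path X Y)
    (hΓ : ∀ t, ((Γ t).points : Set ℂ) = {H t 0, H t 1} ∪ ({p t} ∪ R))
    {β : Path.Homotopic.Quotient X X} {β' : Path.Homotopic.Quotient Y Y}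
    (hβ : IsArcBand ({p 0} ∪ R) (H 0) β) (hβ' : IsArcBand ({p 1} ∪ R) (H 1) β') :
    β.trans (.mk Γ) = (Path.Homotopic.Quotient.mk Γ).trans β' := by
  have hX := hΓ 0
  rw [Γ.source] at hX
  have hRfin : R.Finite := X.points.finite_toSet.subset (by
    rw [hX]; exact Set.subset_union_right.trans Set.subset_union_right)
  have := hRfin.fintype
  have hrange : Set.range (Subtype.val : R → ℂ) = R := Subtype.range_coe
  have hr : ∀ t, Set.range (singleFamily (p t) (Subtype.val : R → ℂ)) = {p t} ∪ R := fun t => by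
    rw [range_singleFamily, hrange]
  have hinj : ∀ t, Function.Injective (singleFamily (p t) (Subtype.val : R → ℂ)) := fun t =>
    singleFamily_injective Subtype.val_injective (hrange.symm ▸ hpR t)
  have hH' : ∀ t, IsArcAvoiding (Set.range (singleFamily (p t) (Subtype.val : R → ℂ))) (H t) :=
    fun t => (hr t).symm ▸ hH t
  have hcard : Fintype.card (Unit ⊕ R) + 2 = n := by
    rw [← Config.card_eq_of_range_eq (X := X)
      (w := pairFamily (H 0 0) (H 0 1) (singleFamily (p 0) (Subtype.val : R → ℂ)))
      ((hH' 0).pairFamily_injective (hinj 0) one_pos le_rfl)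
      (by rw [range_pairFamily, hr, hX])]
    simp; omega
  exact IsArcBand.trans_eq hcard (continuous_singleFamily hp continuous_const) hinj hHc hH' Γ
    (fun t => by rw [hΓ, hr]) (by rw [hr]; exact hβ) (by rw [hr]; exact hβ')

/-- The family consisting of three points and the elements of `R`. -/
def threeFamily (p q s : ℂ) (R : Set ℂ) : Fin 2 ⊕ (Unit ⊕ R) → ℂ :=
  pairFamily p q (singleFamily s Subtype.val)

theorem range_threeFamily (p q s : ℂ) (R : Set ℂ) :
    Set.range (threeFamily p q s R) = {p, q} ∪ ({s} ∪ R) := by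
  rw [threeFamily, range_pairFamily, range_singleFamily, Subtype.range_coe]

/-- `p`, `q`, `s` are distinct points outside of `R`. -/
structure IsTriple (p q s : ℂ) (R : Set ℂ) : Prop where
  ne_left : p ≠ q
  ne_outer : p ≠ s
  ne_right : q ≠ s
  notMem_left : p ∉ R
  notMem_middle : q ∉ R
  notMem_right : s ∉ R

theorem IsTriple.injective_threeFamily {p q s : ℂ} {R : Set ℂ} (h : IsTriple p q s R) :
    Function.Injective (threeFamily p q s R) := by
  refine pairFamily_injective h.ne_left
    (singleFamily_injective Subtype.val_injective (by simpa using h.notMem_right)) ?_ ?_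
  · rw [range_singleFamily, Subtype.range_coe]
    exact fun hp => hp.elim h.ne_outer h.notMem_left
  · rw [range_singleFamily, Subtype.range_coe]
    exact fun hp => hp.elim h.ne_right h.notMem_middle

theorem continuous_threeFamily {Y : Type*} [TopologicalSpace Y] {p q s : Y → ℂ} {R : Set ℂ}
    (hp : Continuous p) (hq : Continuous q) (hs : Continuous s) :
    Continuous fun y => threeFamily (p y) (q y) (s y) R :=
  continuous_pairFamily hp hq (continuous_singleFamily hs continuous_const)

theorem Config.finite_of_eq_union {n : ℕ} {X : Config n ℂ} {p q s : ℂ} {R : Set ℂ}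
    (hX : (X.points : Set ℂ) = {p, q} ∪ ({s} ∪ R)) : R.Finite :=
  X.points.finite_toSet.subset (by
    rw [hX]; exact Set.subset_union_right.trans Set.subset_union_right)

theorem IsTriple.exists_config {n : ℕ} {X : Config n ℂ} {p q s p' q' s' : ℂ} {R : Set ℂ}
    (h : IsTriple p q s R) (hX : (X.points : Set ℂ) = {p, q} ∪ ({s} ∪ R))
    (h' : IsTriple p' q' s' R) :
    ∃ Y : Config n ℂ, (Y.points : Set ℂ) = {p', q'} ∪ ({s'} ∪ R) := by
  have := (Config.finite_of_eq_union hX).fintype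
  obtain ⟨F, hF⟩ := Config.exists_map (Y := Unit)
    (Config.card_eq_of_range_eq h.injective_threeFamily (hX.trans (range_threeFamily _ _ _ _).symm))
    (fun _ => threeFamily p' q' s' R) continuous_const (fun _ => h'.injective_threeFamily)
  exact ⟨F (), (hF ()).trans (range_threeFamily _ _ _ _)⟩

theorem exists_path_of_three {n : ℕ} {X Y : Config n ℂ} {R : Set ℂ} {p q s : I → ℂ}
    (hp : Continuous p) (hq : Continuous q) (hs : Continuous s)
    (h : ∀ t, IsTriple (p t) (q t) (s t) R)
    (hX : (X.points : Set ℂ) = {p 0, q 0} ∪ ({s 0} ∪ R))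
    (hY : (Y.points : Set ℂ) = {p 1, q 1} ∪ ({s 1} ∪ R)) :
    ∃ Γ : Path X Y, ∀ t, ((Γ t).points : Set ℂ) = {p t, q t} ∪ ({s t} ∪ R) := by
  have := (Config.finite_of_eq_union hX).fintype
  obtain ⟨Γ, hΓ⟩ := Config.exists_path (X := X) (Y := Y)
    (Config.card_eq_of_range_eq (h 0).injective_threeFamily
      (hX.trans (range_threeFamily _ _ _ _).symm))
    (fun t => threeFamily (p t) (q t) (s t) R) (continuous_threeFamily hp hq hs)
    (fun t => (h t).injective_threeFamily) (hX.trans (range_threeFamily _ _ _ _).symm)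
    (hY.trans (range_threeFamily _ _ _ _).symm)
  exact ⟨Γ, fun t => (hΓ t).trans (range_threeFamily _ _ _ _)⟩

/-- The bands along two consecutive parts `g [0, 1]` and `g [1, 2]` of an arc satisfy the braid
relation. -/
def BraidRelation {n : ℕ} (X : Config n ℂ) (R : Set ℂ) (g : ℝ → ℂ) : Prop :=
  ∀ α β : Path.Homotopic.Quotient X X, IsArcBand ({g 2} ∪ R) g α →
    IsArcBand ({g 0} ∪ R) (fun s => g (1 + s)) β →
    α.trans (β.trans α) = β.trans (α.trans β)

/-- `g` restricts to an arc on `[0, 2]` that avoids the set `R`. -/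
structure IsLongArcAvoiding (R : Set ℂ) (g : ℝ → ℂ) : Prop where
  continuous : Continuous g
  injOn : Set.InjOn g (Set.Icc 0 2)
  notMem : ∀ s ∈ Set.Icc (0 : ℝ) 2, g s ∉ R

namespace IsLongArcAvoiding

variable {R : Set ℂ} {g : ℝ → ℂ}

theorem ne (h : IsLongArcAvoiding R g) {s t : ℝ} (hs : s ∈ Set.Icc (0 : ℝ) 2)
    (ht : t ∈ Set.Icc (0 : ℝ) 2) (hst : s ≠ t) : g s ≠ g t :=
  fun he => hst (h.injOn hs ht he)

theorem left (h : IsLongArcAvoiding R g) : IsArcAvoiding ({g 2} ∪ R) g := by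
  have hsub : ∀ s ∈ Set.Icc (0 : ℝ) 1, s ∈ Set.Icc (0 : ℝ) 2 := fun s hs =>
    ⟨hs.1, by linarith [hs.2]⟩
  refine ⟨h.continuous, h.injOn.mono hsub, fun s hs hmem => hmem.elim ?_ (h.notMem s (hsub s hs))⟩
  exact h.ne (hsub s hs) (by simp) (by linarith [hs.2])

theorem right (h : IsLongArcAvoiding R g) : IsArcAvoiding ({g 0} ∪ R) fun s => g (1 + s) := by
  have hsub : ∀ s ∈ Set.Icc (0 : ℝ) 1, 1 + s ∈ Set.Icc (0 : ℝ) 2 := fun s hs =>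
    ⟨by linarith [hs.1], by linarith [hs.2]⟩
  refine ⟨h.continuous.comp (by fun_prop), fun s hs t ht he => ?_,
    fun s hs hmem => hmem.elim ?_ (h.notMem _ (hsub s hs))⟩
  · have := h.injOn (hsub s hs) (hsub t ht) he
    linarith
  · exact h.ne (hsub s hs) (by simp) (by linarith [hs.1])

theorem isTriple (h : IsLongArcAvoiding R g) : IsTriple (g 0) (g 1) (g 2) R := by
  refine ⟨h.ne ?_ ?_ ?_, h.ne ?_ ?_ ?_, h.ne ?_ ?_ ?_, h.notMem _ ?_, h.notMem _ ?_,
    h.notMem _ ?_⟩ <;> norm_num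

end IsLongArcAvoiding

theorem insert_pair_rotate (a b c : ℂ) (R : Set ℂ) :
    ({a, b} ∪ ({c} ∪ R) : Set ℂ) = {b, c} ∪ ({a} ∪ R) := by
  ext z
  simp only [Set.mem_union, Set.mem_insert_iff, Set.mem_singleton_iff]
  tauto

/-- The braid relation is invariant under isotopies of the arc. -/
theorem BraidRelation.of_isotopy {n : ℕ} {X : Config n ℂ} {R : Set ℂ} {G : I → ℝ → ℂ}
    (hGc : Continuous (Function.uncurry G)) (hG : ∀ t, IsLongArcAvoiding R (G t))
    (hX : (X.points : Set ℂ) = {G 0 0, G 0 1} ∪ ({G 0 2} ∪ R))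
    (h : ∀ Y : Config n ℂ, (Y.points : Set ℂ) = {G 1 0, G 1 1} ∪ ({G 1 2} ∪ R) →
      BraidRelation Y R (G 1)) : BraidRelation X R (G 0) := by
  intro α β hα hβ
  have hev : ∀ s, Continuous fun t => G t s := fun s =>
    hGc.comp (continuous_id.prodMk continuous_const)
  obtain ⟨Y, hY⟩ := (hG 0).isTriple.exists_config hX (hG 1).isTriple
  obtain ⟨Γ, hΓ⟩ := exists_path_of_three (hev 0) (hev 1) (hev 2) (fun t => (hG t).isTriple) hX hY
  obtain ⟨α', hα'⟩ := exists_isArcBand_of_isArcAvoiding (hG 1).left hY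
  have h12 : (1 : ℝ) + 1 = 2 := by norm_num
  obtain ⟨β', hβ'⟩ := exists_isArcBand_of_isArcAvoiding (X := Y) (hG 1).right
    (by rw [hY, insert_pair_rotate, add_zero, h12])
  -- Each half of the long arc moves isotopically while the far endpoint of the other half is a
  -- moving resting point. Both bands are conjugated by the same `Γ`, so the relation is
  -- transported.
  have h1 := IsArcBand.trans_eq_of_moving_point hGc (hev 2) (fun t => (hG t).isTriple.notMem_right)
    (fun t => (hG t).left) Γ hΓ hα hα'
  have h2 := IsArcBand.trans_eq_of_moving_point (H := fun t s => G t (1 + s))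
    (hGc.comp (by fun_prop : Continuous fun p : I × ℝ => (p.1, 1 + p.2))) (hev 0)
    (fun t => (hG t).isTriple.notMem_left) (fun t => (hG t).right) Γ
    (fun t => by rw [hΓ, insert_pair_rotate, add_zero, h12]) hβ hβ'
  have hrel := h Y hY α' β' hα' hβ'
  have h1' : ∀ x : Path.Homotopic.Quotient Y Y, α.trans ((Path.Homotopic.Quotient.mk Γ).trans x) =
      (Path.Homotopic.Quotient.mk Γ).trans (α'.trans x) := fun x => by
    rw [← Path.Homotopic.Quotient.trans_assoc, h1, Path.Homotopic.Quotient.trans_assoc]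
  have h2' : ∀ x : Path.Homotopic.Quotient Y Y, β.trans ((Path.Homotopic.Quotient.mk Γ).trans x) =
      (Path.Homotopic.Quotient.mk Γ).trans (β'.trans x) := fun x => by
    rw [← Path.Homotopic.Quotient.trans_assoc, h2, Path.Homotopic.Quotient.trans_assoc]
  have h3 : (α.trans (β.trans α)).trans (.mk Γ) = (β.trans (α.trans β)).trans (.mk Γ) := by
    simp only [Path.Homotopic.Quotient.trans_assoc, h1, h2, h1', h2', hrel]
  have h4 := congrArg (fun p => p.trans (Path.Homotopic.Quotient.mk Γ).symm) h3
  simpa using h4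

/-! ### The braid relation for straight segments. -/

/-- When even the disk on the full diameter is clear, contraction is superfluous and the band is the
bare half turn. -/
theorem IsArcBand.eq_mk_of_isClear_one {n : ℕ} {X : Config n ℂ} {R : Set ℂ} {g : ℝ → ℂ}
    (hg : IsArcAvoiding R g) (hclear : IsClear R g 1) (hX : (X.points : Set ℂ) = {g 0, g 1} ∪ R)
    (τ : Path X X) (hτ : ∀ t, ((τ t).points : Set ℂ) =
      {rotPoint (g 0) (g 1) t, rotPoint (g 1) (g 0) t} ∪ R)
    {β : Path.Homotopic.Quotient X X} (hβ : IsArcBand R g β) :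
    β = .mk τ := by
  refine hβ.unique_of_isArcAvoiding hg hX ⟨1, hclear, X, Path.refl X, τ, fun t => ?_, hτ, ?_⟩
  · rw [Path.refl_apply, hX]; simp
  · rw [← Path.Homotopic.Quotient.mk_symm, Path.refl_symm, Path.Homotopic.Quotient.mk_refl,
      Path.Homotopic.Quotient.refl_trans, Path.Homotopic.Quotient.trans_refl]

/-- A parabolic arc from `P` to `Q`, curved upwards. -/
noncomputable def bulge (P Q : ℂ) (k s : ℝ) : ℂ := P + s * (Q - P) + k * Complex.I * (s * (1 - s))

theorem bulge_re (P Q : ℂ) (k s : ℝ) : (bulge P Q k s).re = P.re + s * (Q.re - P.re) := by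
  simp [bulge, Complex.mul_re, Complex.mul_im]

theorem bulge_im (P Q : ℂ) (k s : ℝ) :
    (bulge P Q k s).im = P.im + s * (Q.im - P.im) + k * (s * (1 - s)) := by
  simp [bulge, Complex.mul_re, Complex.mul_im]

@[simp]
theorem bulge_zero (P Q : ℂ) (k : ℝ) : bulge P Q k 0 = P := by simp [bulge]

@[simp]
theorem bulge_one (P Q : ℂ) (k : ℝ) : bulge P Q k 1 = Q := by simp [bulge]

/-- A convex combination of points of norm at most `2`, raised by at most `1`. This fixes the radius
`3` of the disk that must be free of `R`. -/
theorem norm_bulge_le {P Q : ℂ} (hP : ‖P‖ ≤ 2) (hQ : ‖Q‖ ≤ 2) {k s : ℝ} (hk0 : 0 ≤ k)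
    (hk1 : k ≤ 1) (hs : s ∈ Set.Icc (0 : ℝ) 1) : ‖bulge P Q k s‖ ≤ 3 := by
  obtain ⟨hs0, hs1⟩ := hs
  have h1 : bulge P Q k s = ((1 - s : ℝ) : ℂ) * P + (s : ℂ) * Q +
      ((k * (s * (1 - s)) : ℝ) : ℂ) * Complex.I := by
    rw [bulge]; push_cast; ring
  have h2 : ‖((1 - s : ℝ) : ℂ) * P‖ ≤ (1 - s) * 2 := by
    rw [norm_mul, Complex.norm_of_nonneg (by linarith)]
    exact mul_le_mul_of_nonneg_left hP (by linarith)
  have h3 : ‖(s : ℂ) * Q‖ ≤ s * 2 := by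
    rw [norm_mul, Complex.norm_of_nonneg hs0]
    exact mul_le_mul_of_nonneg_left hQ hs0
  have h4 : 0 ≤ s * (1 - s) := mul_nonneg hs0 (by linarith)
  have h5 : ‖((k * (s * (1 - s)) : ℝ) : ℂ) * Complex.I‖ ≤ 1 := by
    rw [norm_mul, Complex.norm_I, mul_one, Complex.norm_of_nonneg (mul_nonneg hk0 h4)]
    have : k * (s * (1 - s)) ≤ 1 * (s * (1 - s)) := mul_le_mul_of_nonneg_right hk1 h4
    nlinarith
  rw [h1]
  exact (norm_add₃_le).trans (by linarith)

/-- The conditions under which a parabolic arc from `P` to `Q` avoids the point `T`. -/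
structure IsBulgePosition (P Q T : ℂ) (k : ℝ) : Prop where
  re_lt : P.re < Q.re
  im_left : 0 ≤ P.im
  im_right : 0 ≤ Q.im
  im_point : T.im ≤ 0
  ne_left : P ≠ T
  ne_right : Q ≠ T
  nonneg : 0 ≤ k
  le_one : k ≤ 1
  pos_or : 0 < k ∨ T.re < P.re ∨ Q.re < T.re
  norm_left : ‖P‖ ≤ 2
  norm_right : ‖Q‖ ≤ 2
  norm_point : ‖T‖ ≤ 2

/-- At interior parameters either `k > 0` and the arc is strictly above the real axis, while `T` is
not, or the real part stays strictly between those of the endpoints, while that of `T` is outside.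
-/
theorem IsBulgePosition.bulge_ne {P Q T : ℂ} {k : ℝ} (h : IsBulgePosition P Q T k) {s : ℝ}
    (hs : s ∈ Set.Icc (0 : ℝ) 1) : bulge P Q k s ≠ T := by
  intro he
  rcases hs.1.eq_or_lt with rfl | hs0
  · exact h.ne_left (by simpa using he)
  rcases hs.2.eq_or_lt with rfl | hs1
  · exact h.ne_right (by simpa using he)
  have hre := congrArg Complex.re he
  have him := congrArg Complex.im he
  rw [bulge_re] at hre
  rw [bulge_im] at him
  have h0 := h.re_lt
  rcases h.pos_or with hk | hT | hT
  · have h1 : 0 < k * (s * (1 - s)) := mul_pos hk (mul_pos hs0 (by linarith))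
    have h2 : 0 ≤ s * Q.im := mul_nonneg hs0.le h.im_right
    have h3 : 0 ≤ (1 - s) * P.im := mul_nonneg (by linarith) h.im_left
    have := h.im_point
    nlinarith
  · nlinarith
  · nlinarith

section Affine

variable {n : ℕ} {X Y : Config n ℂ} {R : Set ℂ} {c w : ℂ}

theorem affine_injective (c : ℂ) (hw : w ≠ 0) : Function.Injective fun u : ℂ => c + w * u :=
  (add_right_injective c).comp (mul_right_injective₀ hw)

/-- Injectivity holds because the real part of the parabola is strictly increasing. -/
theorem IsBulgePosition.isArcAvoiding (hw : w ≠ 0) (hR : ∀ u : ℂ, ‖u‖ ≤ 3 → c + w * u ∉ R)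
    {P Q T : ℂ} {k : ℝ} (h : IsBulgePosition P Q T k) :
    IsArcAvoiding ({c + w * T} ∪ R) fun s => c + w * bulge P Q k s := by
  refine ⟨by unfold bulge; fun_prop, fun s _ t _ he => ?_, fun s hs hmem => hmem.elim ?_ ?_⟩
  · have h1 := congrArg Complex.re (affine_injective c hw he)
    rw [bulge_re, bulge_re] at h1
    have h2 := h.re_lt
    have h3 : (s - t) * (Q.re - P.re) = 0 := by linarith
    rcases mul_eq_zero.1 h3 with h4 | h4 <;> linarith
  · exact fun he => h.bulge_ne hs (affine_injective c hw he)
  · exact hR _ (norm_bulge_le h.norm_left h.norm_right h.nonneg h.le_one hs)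

theorem IsArcBand.trans_eq_bulge (hw : w ≠ 0) (hR : ∀ u : ℂ, ‖u‖ ≤ 3 → c + w * u ∉ R)
    {P Q T : I → ℂ} {k : I → ℝ} (hP : Continuous P) (hQ : Continuous Q) (hT : Continuous T)
    (hk : Continuous k) (h : ∀ t, IsBulgePosition (P t) (Q t) (T t) (k t)) (Γ : Path X Y)
    (hΓ : ∀ t, ((Γ t).points : Set ℂ) = {c + w * P t, c + w * Q t} ∪ ({c + w * T t} ∪ R))
    {β : Path.Homotopic.Quotient X X} {β' : Path.Homotopic.Quotient Y Y}
    (hβ : IsArcBand ({c + w * T 0} ∪ R) (fun s => c + w * bulge (P 0) (Q 0) (k 0) s) β)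
    (hβ' : IsArcBand ({c + w * T 1} ∪ R) (fun s => c + w * bulge (P 1) (Q 1) (k 1) s) β') :
    β.trans (.mk Γ) = (Path.Homotopic.Quotient.mk Γ).trans β' := by
  refine IsArcBand.trans_eq_of_moving_point
    (H := fun t s => c + w * bulge (P t) (Q t) (k t) s) ?_ (p := fun t => c + w * T t)
    (by fun_prop) (fun t => hR _ ((h t).norm_point.trans (by norm_num)))
    (fun t => (h t).isArcAvoiding hw hR) Γ (fun t => ?_) hβ hβ'
  · unfold bulge Function.uncurry
    fun_prop
  · rw [hΓ, bulge_zero, bulge_one]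

/-- Bending the arc does not change the band. -/
theorem IsArcBand.bulge_of_straight (hw : w ≠ 0) (hR : ∀ u : ℂ, ‖u‖ ≤ 3 → c + w * u ∉ R)
    {P Q T : ℂ} (h : IsBulgePosition P Q T 0) {β : Path.Homotopic.Quotient X X}
    (hX : (X.points : Set ℂ) = {c + w * P, c + w * Q} ∪ ({c + w * T} ∪ R))
    (hβ : IsArcBand ({c + w * T} ∪ R) (fun s => c + w * bulge P Q 0 s) β) :
    IsArcBand ({c + w * T} ∪ R) (fun s => c + w * bulge P Q 1 s) β := by
  -- For `k = 0` the point `T` lies outside the vertical strip over the segment, so the arc can be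
  -- bent up with its endpoints at rest; the connecting path is constant and the band unchanged.
  have hpos : ∀ t : I, IsBulgePosition P Q T t := fun t =>
    { h with nonneg := t.2.1, le_one := t.2.2, pos_or := Or.inr (h.pos_or.resolve_left (lt_irrefl _)) }
  obtain ⟨β', hβ'⟩ := exists_isArcBand_of_isArcAvoiding (X := X)
    ((hpos 1).isArcAvoiding hw hR) (by rw [hX, bulge_zero, bulge_one])
  have h1 := IsArcBand.trans_eq_bulge hw hR (P := fun _ => P) (Q := fun _ => Q) (T := fun _ => T)
    (k := fun t => t) continuous_const continuous_const continuous_const continuous_subtype_val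
    hpos (Path.refl X) (fun t => by rw [Path.refl_apply, hX]) hβ hβ'
  rw [Path.Homotopic.Quotient.mk_refl, Path.Homotopic.Quotient.trans_refl,
    Path.Homotopic.Quotient.refl_trans] at h1
  rw [h1]
  exact hβ'

end Affine

theorem rotPoint_ofReal_re (a b t : ℝ) :
    (rotPoint a b t).re = (a + b) / 2 + Real.cos (Real.pi * t) * ((a - b) / 2) := by
  have h : rotPoint a b t = (((a + b) / 2 : ℝ) : ℂ) +
      Complex.exp ((Real.pi * t : ℝ) * Complex.I) * (((a - b) / 2 : ℝ) : ℂ) := by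
    unfold rotPoint; push_cast; ring_nf
  rw [h, Complex.add_re, Complex.ofReal_re, Complex.re_mul_ofReal, Complex.exp_ofReal_mul_I_re]

theorem rotPoint_ofReal_im (a b t : ℝ) :
    (rotPoint a b t).im = Real.sin (Real.pi * t) * ((a - b) / 2) := by
  have h : rotPoint a b t = (((a + b) / 2 : ℝ) : ℂ) +
      Complex.exp ((Real.pi * t : ℝ) * Complex.I) * (((a - b) / 2 : ℝ) : ℂ) := by
    unfold rotPoint; push_cast; ring_nf
  rw [h, Complex.add_im, Complex.ofReal_im, Complex.im_mul_ofReal, Complex.exp_ofReal_mul_I_im,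
    zero_add]

theorem norm_rotPoint_le (a b : ℝ) (t : ℝ) : ‖rotPoint a b t‖ ≤ |a + b| / 2 + |a - b| / 2 := by
  have h1 := dist_rotPoint a b t
  have h2 : ‖((a : ℂ) + b) / 2‖ = |a + b| / 2 := by
    rw [norm_div, ← Complex.ofReal_add, Complex.norm_real, Real.norm_eq_abs]; simp
  have h3 : dist (a : ℂ) b = |a - b| := by
    rw [dist_eq_norm, ← Complex.ofReal_sub, Complex.norm_real, Real.norm_eq_abs]
  rw [dist_eq_norm, h3] at h1
  calc ‖rotPoint a b t‖ = ‖(a + b) / 2 + (rotPoint a b t - (a + b) / 2)‖ := by ring_nf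
    _ ≤ _ := (norm_add_le _ _).trans (by rw [h1, h2])

theorem sin_pi_mul_nonneg (t : I) : 0 ≤ Real.sin (Real.pi * t) :=
  Real.sin_nonneg_of_nonneg_of_le_pi (mul_nonneg Real.pi_pos.le t.2.1)
    (mul_le_of_le_one_right Real.pi_pos.le t.2.2)

/-- The point `1` travels to `0` along the upper semicircle and `0` to `1` along the lower one. An
arc that bulges upwards from the former to `2` is never hit by the latter. -/
theorem isBulgePosition_rotPoint_left (t : I) :
    IsBulgePosition (rotPoint 1 0 t) 2 (rotPoint 0 1 t) 1 := by
  have hs := sin_pi_mul_nonneg t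
  have hc1 := Real.neg_one_le_cos (Real.pi * t)
  have hc2 := Real.cos_le_one (Real.pi * t)
  have h1 := rotPoint_ofReal_re 1 0 t
  have h2 := rotPoint_ofReal_im 1 0 t
  have h3 := rotPoint_ofReal_re 0 1 t
  have h4 := rotPoint_ofReal_im 0 1 t
  have h5 := norm_rotPoint_le 1 0 t
  have h6 := norm_rotPoint_le 0 1 t
  norm_num at h1 h2 h3 h4 h5 h6
  refine ⟨?_, ?_, ?_, ?_, rotPoint_ne one_ne_zero t, ?_, zero_le_one, le_rfl, Or.inl one_pos, ?_,
    ?_, ?_⟩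
  · rw [h1]; norm_num; linarith
  · rw [h2]; linarith
  · simp
  · rw [h4]; linarith
  · intro h
    have := congrArg Complex.re h
    rw [h3] at this; norm_num at this; linarith
  · linarith
  · simp
  · linarith

/-- The same for the other turn: `2` travels to `1` above the axis, dragging the end of an arc from
`0`, while `1` passes to `2` below. -/
theorem isBulgePosition_rotPoint_right (t : I) :
    IsBulgePosition 0 (rotPoint 2 1 t) (rotPoint 1 2 t) 1 := by
  have hs := sin_pi_mul_nonneg t
  have hc1 := Real.neg_one_le_cos (Real.pi * t)
  have hc2 := Real.cos_le_one (Real.pi * t)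
  have h1 := rotPoint_ofReal_re 2 1 t
  have h2 := rotPoint_ofReal_im 2 1 t
  have h3 := rotPoint_ofReal_re 1 2 t
  have h4 := rotPoint_ofReal_im 1 2 t
  have h5 := norm_rotPoint_le 2 1 t
  have h6 := norm_rotPoint_le 1 2 t
  norm_num at h1 h2 h3 h4 h5 h6
  refine ⟨?_, ?_, ?_, ?_, ?_, rotPoint_ne (by norm_num) t, zero_le_one, le_rfl, Or.inl one_pos, ?_,
    ?_, ?_⟩
  · rw [h1]; norm_num; linarith
  · simp
  · rw [h2]; linarith
  · rw [h4]; linarith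
  · intro h
    have := congrArg Complex.re h
    rw [h3] at this; norm_num at this; linarith
  · simp
  · linarith
  · linarith

section Straight

variable {n : ℕ} {X : Config n ℂ} {R : Set ℂ} {c w : ℂ}

theorem bulge_straight (a s : ℝ) : bulge a (a + 1) 0 s = a + s := by simp [bulge]

/-- In the coordinate `u`, the disks have diameters `[a, a + s]` and lie within norm `2`. The real
point `T` is outside `[a, a + 1]`, and `R` is beyond norm `3`. -/
theorem isClear_straight (hw : w ≠ 0) (hR : ∀ u : ℂ, ‖u‖ ≤ 3 → c + w * u ∉ R) {a T : ℝ}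
    (ha0 : 0 ≤ a) (ha1 : a ≤ 1) (hT : T < a ∨ a + 1 < T) :
    IsClear ({c + w * T} ∪ R) (fun s => c + w * bulge a (a + 1) 0 s) 1 := by
  have hw' : 0 < ‖w‖ := norm_pos_iff.2 hw
  refine ⟨one_pos, le_rfl, fun s hs z hz => ?_⟩
  obtain ⟨hs0, hs1⟩ := hs
  obtain ⟨u, rfl⟩ : ∃ u, c + w * u = z := ⟨(z - c) / w, by field_simp; ring⟩
  have hu : s / 2 < ‖u - ((a + s / 2 : ℝ) : ℂ)‖ := by
    rcases hz with hz | hz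
    · rw [affine_injective c hw hz, ← Complex.ofReal_sub, Complex.norm_real, Real.norm_eq_abs,
        lt_abs]
      rcases hT with hT | hT
      · right; linarith
      · left; linarith
    · have h1 : 3 < ‖u‖ := not_le.1 fun h => hR u h hz
      have h2 : ‖((a + s / 2 : ℝ) : ℂ)‖ = a + s / 2 := Complex.norm_of_nonneg (by linarith)
      have h3 := norm_sub_norm_le u ((a + s / 2 : ℝ) : ℂ)
      linarith
  simp only [bulge_straight]
  have h1 : dist (c + w * (a + ((0 : ℝ) : ℂ))) (c + w * (a + (s : ℂ))) = ‖w‖ * s := by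
    rw [dist_eq_norm, show c + w * (a + ((0 : ℝ) : ℂ)) - (c + w * (a + (s : ℂ))) = -(w * s) by
      push_cast; ring, norm_neg, norm_mul, Complex.norm_of_nonneg hs0]
  have h2 : dist (c + w * u) ((c + w * (a + ((0 : ℝ) : ℂ)) + (c + w * (a + (s : ℂ)))) / 2) =
      ‖w‖ * ‖u - ((a + s / 2 : ℝ) : ℂ)‖ := by
    rw [dist_eq_norm, ← norm_mul]
    congr 1
    push_cast; ring
  rw [h1, h2, mul_div_assoc]
  exact mul_lt_mul_of_pos_left hu hw'

theorem isBulgePosition_straight {a T : ℝ} (ha0 : 0 ≤ a) (ha1 : a ≤ 1) (hT0 : 0 ≤ T) (hT2 : T ≤ 2)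
    (hT : T < a ∨ a + 1 < T) : IsBulgePosition a (a + 1) T 0 := by
  refine ⟨by simp, by simp, by simp, by simp, ?_, ?_, le_rfl, zero_le_one,
    Or.inr (by simpa using hT), ?_, ?_, ?_⟩
  · intro h
    have := Complex.ofReal_injective h
    rcases hT with hT | hT <;> linarith
  · intro h
    have : a + 1 = T := Complex.ofReal_injective (by push_cast; exact h)
    rcases hT with hT | hT <;> linarith
  · rw [Complex.norm_of_nonneg ha0]; linarith
  · rw [← Complex.ofReal_one, ← Complex.ofReal_add, Complex.norm_of_nonneg (by linarith)]; linarith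
  · rw [Complex.norm_of_nonneg hT0]; exact hT2

/-- The braid relation for two consecutive straight segments of equal length. -/
theorem braidRelation_straight (hw : w ≠ 0) (hR : ∀ u : ℂ, ‖u‖ ≤ 3 → c + w * u ∉ R)
    (hX : (X.points : Set ℂ) = {c + w * 0, c + w * 1} ∪ ({c + w * 2} ∪ R)) :
    BraidRelation X R fun s => c + w * s := by
  intro α β hα hβ
  have hinj := affine_injective c hw
  have hX' : (X.points : Set ℂ) = {c + w * 1, c + w * 2} ∪ ({c + w * 0} ∪ R) := by
    rw [hX, insert_pair_rotate]
  have pos1 := isBulgePosition_straight (a := 0) (T := 2) le_rfl zero_le_one zero_le_two le_rfl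
    (Or.inr (by norm_num))
  have pos2 := isBulgePosition_straight (a := 1) (T := 0) zero_le_one le_rfl le_rfl zero_le_two
    (Or.inl (by norm_num))
  have clear1 := isClear_straight hw hR (a := 0) (T := 2) le_rfl zero_le_one (Or.inr (by norm_num))
  have clear2 := isClear_straight hw hR (a := 1) (T := 0) zero_le_one le_rfl (Or.inl (by norm_num))
  have e2 : (1 : ℂ) + 1 = 2 := by norm_num
  simp only [Complex.ofReal_zero, Complex.ofReal_one, Complex.ofReal_ofNat, zero_add, e2]
    at pos1 pos2 clear1 clear2
  have hα1 : IsArcBand ({c + w * 2} ∪ R) (fun s => c + w * bulge 0 1 0 s) α := by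
    simpa [bulge] using hα
  have hβ1 : IsArcBand ({c + w * 0} ∪ R) (fun s => c + w * bulge 1 2 0 s) β := by
    have : (2 : ℂ) - 1 = 1 := by norm_num
    simpa [bulge, this] using hβ
  have hα2 := hα1.bulge_of_straight hw hR pos1 hX
  have hβ2 := hβ1.bulge_of_straight hw hR pos2 hX'
  have htri1 : ∀ t : I, IsTriple (c + w * rotPoint 1 0 t) (c + w * 2) (c + w * rotPoint 0 1 t) R :=
    fun t => have h := isBulgePosition_rotPoint_left t
      ⟨fun he => h.re_lt.ne (congrArg Complex.re (hinj he)), fun he => h.ne_left (hinj he),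
        fun he => h.ne_right (hinj he), hR _ (h.norm_left.trans (by norm_num)),
        hR _ (h.norm_right.trans (by norm_num)), hR _ (h.norm_point.trans (by norm_num))⟩
  have htri2 : ∀ t : I, IsTriple (c + w * 0) (c + w * rotPoint 2 1 t) (c + w * rotPoint 1 2 t) R :=
    fun t => have h := isBulgePosition_rotPoint_right t
      ⟨fun he => h.re_lt.ne (congrArg Complex.re (hinj he)), fun he => h.ne_left (hinj he),
        fun he => h.ne_right (hinj he), hR _ (h.norm_left.trans (by norm_num)),
        hR _ (h.norm_right.trans (by norm_num)), hR _ (h.norm_point.trans (by norm_num))⟩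
  obtain ⟨τ, hτ⟩ := exists_path_of_three (X := X) (Y := X) (by fun_prop) (by fun_prop)
    (by fun_prop) htri1 (by simp only [Set.Icc.coe_zero, rotPoint_zero]; exact hX')
    (by
      simp only [Set.Icc.coe_one, rotPoint_one]
      rw [hX, insert_pair_rotate, insert_pair_rotate, Set.pair_comm])
  obtain ⟨τ', hτ'⟩ := exists_path_of_three (X := X) (Y := X) (by fun_prop) (by fun_prop)
    (by fun_prop) htri2
    (by
      simp only [Set.Icc.coe_zero, rotPoint_zero]
      rw [hX, insert_pair_rotate, insert_pair_rotate, Set.pair_comm, insert_pair_rotate,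
        insert_pair_rotate])
    (by simp only [Set.Icc.coe_one, rotPoint_one]; exact hX)
  have hατ : α = .mk τ := by
    refine hα1.eq_mk_of_isClear_one (pos1.isArcAvoiding hw hR) clear1
      (by rw [bulge_zero, bulge_one, hX]) τ fun t => ?_
    rw [hτ, bulge_zero, bulge_one, rotPoint_affine, rotPoint_affine, insert_pair_rotate,
      insert_pair_rotate]
  have hβτ : β = .mk τ' := by
    refine hβ1.eq_mk_of_isClear_one (pos2.isArcAvoiding hw hR) clear2
      (by rw [bulge_zero, bulge_one, hX']) τ' fun t => ?_
    rw [hτ', bulge_zero, bulge_one, rotPoint_affine, rotPoint_affine, insert_pair_rotate,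
      Set.pair_comm]
  -- The band along the arc from `0` to `2` that passes above `1`. Turning `0`, `1` carries the arc
  -- of `β` to it, and turning `1`, `2` carries it on to the arc of `α`.
  obtain ⟨δ, hδ⟩ := exists_isArcBand_of_isArcAvoiding (X := X)
    ((isBulgePosition_rotPoint_left 1).isArcAvoiding hw hR)
    (by
      rw [bulge_zero, bulge_one]
      simp only [Set.Icc.coe_one, rotPoint_one]
      rw [hX, insert_pair_rotate, insert_pair_rotate, Set.pair_comm])
  have h1 : β.trans (.mk τ) = (Path.Homotopic.Quotient.mk τ).trans δ := by
    refine IsArcBand.trans_eq_bulge hw hR (by fun_prop) continuous_const (by fun_prop)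
      (k := fun _ => 1) continuous_const isBulgePosition_rotPoint_left τ hτ ?_ hδ
    simpa [rotPoint_zero] using hβ2
  have h2 : δ.trans (.mk τ') = (Path.Homotopic.Quotient.mk τ').trans α := by
    refine IsArcBand.trans_eq_bulge hw hR continuous_const (by fun_prop) (by fun_prop)
      (k := fun _ => 1) continuous_const isBulgePosition_rotPoint_right τ' hτ' ?_ ?_
    · simpa [rotPoint_zero, rotPoint_one] using hδ
    · simpa [rotPoint_one] using hα2
  rw [← hατ] at h1
  rw [← hβτ] at h2
  -- The computation `α (β α) = α (δ β) = (α δ) β = (β α) β`.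
  rw [← h2, ← Path.Homotopic.Quotient.trans_assoc, ← h1, Path.Homotopic.Quotient.trans_assoc]

end Straight

/-! ### Straightening a long arc near its initial point. -/

/-- An arc with a nonzero strict derivative at its initial point satisfies the braid relation. -/
theorem BraidRelation.of_hasStrictDerivAt {n : ℕ} {X : Config n ℂ} {R : Set ℂ} {g : ℝ → ℂ}
    (hg : IsLongArcAvoiding R g) (hX : (X.points : Set ℂ) = {g 0, g 1} ∪ ({g 2} ∪ R))
    {d : ℂ} (hd : d ≠ 0) (hderiv : HasStrictDerivAt g d 0) : BraidRelation X R g := by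
  have hd' : 0 < ‖d‖ := norm_pos_iff.2 hd
  have hgc := hg.continuous
  have hclosed : IsClosed R := (Config.finite_of_eq_union hX).isClosed
  obtain ⟨ρ, hρ, hball⟩ := Metric.isOpen_iff.1 hclosed.isOpen_compl (g 0)
    (hg.notMem 0 (by simp))
  have hlip : ∀ᶠ p : ℝ × ℝ in 𝓝 (0, 0),
      ‖g p.1 - g p.2 - (p.1 - p.2) • d‖ ≤ ‖d‖ / 2 * ‖p.1 - p.2‖ := by
    have := (hasStrictDerivAt_iff_hasStrictFDerivAt.1 hderiv).isLittleO.bound (half_pos hd')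
    simpa using this
  obtain ⟨η, hη, hη'⟩ := Metric.eventually_nhds_iff.1 hlip
  -- The bound `2 * ε < η` makes the derivative estimate valid on `[0, 2 * ε]`, and `3 * ε * ‖d‖ <
  -- ρ` frees from `R` the image of the disk of radius `3` under `u ↦ g 0 + ε * d * u`.
  obtain ⟨ε, hε0, hε1, hεη, hερ⟩ : ∃ ε : ℝ, 0 < ε ∧ ε ≤ 1 ∧ 2 * ε < η ∧ 3 * ε * ‖d‖ < ρ := by
    refine ⟨min (min 1 (η / 3)) (ρ / (4 * ‖d‖)), by positivity, ?_, ?_, ?_⟩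
    · exact (min_le_left _ _).trans (min_le_left _ _)
    · have : min (min 1 (η / 3)) (ρ / (4 * ‖d‖)) ≤ η / 3 :=
        (min_le_left _ _).trans (min_le_right _ _)
      linarith
    · have h1 : min (min 1 (η / 3)) (ρ / (4 * ‖d‖)) ≤ ρ / (4 * ‖d‖) := min_le_right _ _
      have h2 := mul_le_mul_of_nonneg_right h1 hd'.le
      have h3 : ρ / (4 * ‖d‖) * ‖d‖ = ρ / 4 := by field_simp
      rw [h3] at h2
      nlinarith
  have hest : ∀ s ∈ Set.Icc (0 : ℝ) 2, ∀ t ∈ Set.Icc (0 : ℝ) 2,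
      ‖g (ε * s) - g (ε * t) - ((ε * s - ε * t : ℝ) : ℂ) * d‖ ≤ ‖d‖ / 2 * |ε * s - ε * t| := by
    intro s hs t ht
    have hsmall : ∀ u ∈ Set.Icc (0 : ℝ) 2, dist (ε * u) 0 < η := fun u hu => by
      rw [Real.dist_0_eq_abs, abs_of_nonneg (mul_nonneg hε0.le hu.1)]
      nlinarith [hu.2]
    have := hη' (y := (ε * s, ε * t)) (max_lt (hsmall s hs) (hsmall t ht))
    rwa [Complex.real_smul, Real.norm_eq_abs] at this
  have hfar : ∀ z : ℂ, ‖z‖ ≤ 3 * ε * ‖d‖ → g 0 + z ∉ R := fun z hz => hball (by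
    rw [Metric.mem_ball, dist_eq_norm, add_sub_cancel_left]
    linarith)
  have hshrink : ∀ t : I, ∀ s ∈ Set.Icc (0 : ℝ) 2, (1 - t * (1 - ε)) * s ∈ Set.Icc (0 : ℝ) 2 :=
    fun t s hs => by
      have h := one_sub_mul_mem hε1 t
      exact ⟨mul_nonneg (hε0.le.trans h.1) hs.1,
        (mul_le_of_le_one_left hs.1 h.2).trans hs.2⟩
  have hG : ∀ t : I, IsLongArcAvoiding R fun s => g ((1 - t * (1 - ε)) * s) := fun t => by
    refine ⟨by fun_prop, fun s hs s' hs' he => ?_, fun s hs => hg.notMem _ (hshrink t s hs)⟩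
    have := hg.injOn (hshrink t s hs) (hshrink t s' hs') he
    exact mul_left_cancel₀ (hε0.trans_le (one_sub_mul_mem hε1 t).1).ne' this
  -- Shrinking along itself brings the whole long arc into the region where it is close to its
  -- tangent. A corner at parameter `1`, as in a concatenation, does no harm.
  have hmain := BraidRelation.of_isotopy (n := n) (X := X) (R := R)
    (G := fun t s => g ((1 - t * (1 - ε)) * s)) (by unfold Function.uncurry; fun_prop) hG
    (by simpa using hX)
  simp only [Set.Icc.coe_zero, Set.Icc.coe_one, zero_mul, sub_zero, one_mul,
    sub_sub_cancel] at hmain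
  refine hmain fun Y hY => ?_
  -- Linear interpolation to the tangent. Chords deviate from their linear approximation by at most
  -- half its length, so they cannot vanish at any stage. The distance to `g 0` is at most `3 / 2`
  -- times `2 * ε * ‖d‖`, which is exactly the free radius.
  have hG' : ∀ t : I, IsLongArcAvoiding R fun s =>
      ((1 - t : ℝ) : ℂ) * g (ε * s) + ((t : ℝ) : ℂ) * (g 0 + ε * d * s) := fun t => by
    have ht0 := t.2.1
    have ht1 := t.2.2
    refine ⟨by fun_prop, fun s hs s' hs' he => ?_, fun s hs => ?_⟩
    · by_contra hne
      have habs : 0 < |ε * s - ε * s'| := by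
        rw [abs_pos, ← mul_sub]
        exact mul_ne_zero hε0.ne' (sub_ne_zero.2 hne)
      have h1 := hest s hs s' hs'
      have h2 : ((1 - t : ℝ) : ℂ) * (g (ε * s) - g (ε * s') - ((ε * s - ε * s' : ℝ) : ℂ) * d) =
          -(((ε * s - ε * s' : ℝ) : ℂ) * d) := by
        push_cast at he ⊢
        linear_combination he
      have h3 := congrArg norm h2
      rw [norm_neg, norm_mul, norm_mul, Complex.norm_of_nonneg (by linarith), Complex.norm_real,
        Real.norm_eq_abs] at h3
      have h4 : (1 - t : ℝ) * ‖g (ε * s) - g (ε * s') - ((ε * s - ε * s' : ℝ) : ℂ) * d‖ ≤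
          1 * (‖d‖ / 2 * |ε * s - ε * s'|) :=
        mul_le_mul (by linarith) h1 (norm_nonneg _) zero_le_one
      rw [h3] at h4
      nlinarith [mul_pos habs hd']
    · have h1 := hest s hs 0 (by simp)
      have h2 : ((1 - t : ℝ) : ℂ) * g (ε * s) + ((t : ℝ) : ℂ) * (g 0 + ε * d * s) =
          g 0 + (((1 - t : ℝ) : ℂ) * (g (ε * s) - g (ε * 0) - ((ε * s - ε * 0 : ℝ) : ℂ) * d) +
            ((ε * s : ℝ) : ℂ) * d) := by
        push_cast
        rw [mul_zero]
        ring
      rw [h2]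
      refine hfar _ ((norm_add_le _ _).trans ?_)
      have hs0 : 0 ≤ ε * s := mul_nonneg hε0.le hs.1
      rw [norm_mul, norm_mul, Complex.norm_of_nonneg (by linarith), Complex.norm_of_nonneg hs0]
      rw [mul_zero, sub_zero, abs_of_nonneg hs0] at h1
      have h4 : (1 - t : ℝ) * ‖g (ε * s) - g (ε * 0) - ((ε * s - ε * 0 : ℝ) : ℂ) * d‖ ≤
          1 * (‖d‖ / 2 * (ε * s)) :=
        mul_le_mul (by linarith) (by simpa using h1) (norm_nonneg _) zero_le_one
      have h5 : ε * s * ‖d‖ ≤ ε * 2 * ‖d‖ :=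
        mul_le_mul_of_nonneg_right (mul_le_mul_of_nonneg_left hs.2 hε0.le) hd'.le
      nlinarith
  have hmain' := BraidRelation.of_isotopy (n := n) (X := Y) (R := R)
    (G := fun t s => ((1 - t : ℝ) : ℂ) * g (ε * s) + ((t : ℝ) : ℂ) * (g 0 + ε * d * s))
    (by unfold Function.uncurry; fun_prop) hG' (by simpa using hY)
  simp only [Set.Icc.coe_zero, Set.Icc.coe_one, sub_zero, Complex.ofReal_one, one_mul,
    Complex.ofReal_zero, zero_mul, add_zero, sub_self, zero_add] at hmain'
  refine hmain' fun Z hZ => braidRelation_straight (mul_ne_zero (by exact_mod_cast hε0.ne') hd)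
    (fun u hu => hfar _ ?_) (by simpa using hZ)
  rw [norm_mul, norm_mul, Complex.norm_of_nonneg hε0.le]
  nlinarith [mul_pos hε0 hd']

/-- Only the values on `[0, 1]` enter the band loop; this identifies the halves of a concatenated
arc with the original arcs. -/
theorem IsArcBand.congr {n : ℕ} {X : Config n ℂ} {R : Set ℂ} {g g' : ℝ → ℂ}
    {β : Path.Homotopic.Quotient X X} (hβ : IsArcBand R g β)
    (h : Set.EqOn g g' (Set.Icc 0 1)) : IsArcBand R g' β := by
  obtain ⟨ε, hε, Y, γ, τ, hγ, hτ, hβ⟩ := hβ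
  have h0 : g 0 = g' 0 := h (by simp)
  have hε' : g ε = g' ε := h ⟨hε.pos.le, hε.le_one⟩
  refine ⟨ε, ⟨hε.pos, hε.le_one, fun s hs => ?_⟩, Y, γ, τ, fun t => ?_, fun t => ?_, hβ⟩
  · rw [← h0, ← h ⟨hs.1, hs.2.trans hε.le_one⟩]
    exact hε.lt_dist s hs
  · have := one_sub_mul_mem hε.le_one t
    rw [hγ, h0, h ⟨hε.pos.le.trans this.1, this.2⟩]
  · rw [hτ, h0, hε']

/-- An edge has a parametrization ending at a given endpoint, with nonzero derivative at its
origin. -/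
theorem Edge.exists_isParam_one_eq (e : Edge) {x : ℂ} (hx : x ∈ (e.boundary.points : Set ℂ)) :
    ∃ g : ℝ → ℂ, e.IsParam g ∧ g 1 = x ∧ ∃ d, d ≠ 0 ∧ HasStrictDerivAt g d 0 := by
  have hderiv : ∀ s, HasStrictDerivAt e.param (deriv e.param s) s := fun s =>
    e.contDiff_param.contDiffAt.hasStrictDerivAt (by simp)
  rw [e.coe_points_boundary] at hx
  rcases hx with rfl | rfl
  · refine ⟨_, e.isParam_reverse, by simp, -deriv e.param 1,
      neg_ne_zero.2 (e.deriv_param_ne 1 (by simp)), ?_⟩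
    have h1 : HasStrictDerivAt (fun s : ℝ => 1 - s) (-1) 0 := (hasStrictDerivAt_id 0).const_sub 1
    have h2 := HasStrictDerivAt.scomp (h := fun s : ℝ => 1 - s) (x := 0) (g₁ := e.param)
      (g₁' := deriv e.param 1) (by simpa using hderiv 1) h1
    simpa [Function.comp_def] using h2
  · exact ⟨_, e.isParam_param, rfl, _, e.deriv_param_ne 0 (by simp), hderiv 0⟩

theorem Edge.exists_isParam_zero_eq (e : Edge) {x : ℂ} (hx : x ∈ (e.boundary.points : Set ℂ)) :
    ∃ g : ℝ → ℂ, e.IsParam g ∧ g 0 = x := by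
  rw [e.coe_points_boundary] at hx
  rcases hx with rfl | rfl
  · exact ⟨_, e.isParam_param, rfl⟩
  · exact ⟨_, e.isParam_reverse, by simp⟩

/-- The concatenation of two arcs. -/
noncomputable def concatArc (g h : ℝ → ℂ) (s : ℝ) : ℂ := if s ≤ 1 then g s else h (s - 1)

theorem concatArc_of_le {g h : ℝ → ℂ} {s : ℝ} (hs : s ≤ 1) : concatArc g h s = g s := if_pos hs

theorem concatArc_one_add {g h : ℝ → ℂ} (hgh : g 1 = h 0) {s : ℝ} (hs : 0 ≤ s) :
    concatArc g h (1 + s) = h s := by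
  rcases hs.eq_or_lt with rfl | hs
  · rw [add_zero, concatArc_of_le le_rfl, hgh]
  · rw [concatArc, if_neg (by linarith), add_sub_cancel_left]

/-- The two images meet only in `h 0`, a value that `h` takes at no other parameter, so no point of
`g` recurs on the second half. -/
theorem isLongArcAvoiding_concatArc {R : Set ℂ} {g h : ℝ → ℂ} (hg : IsArcAvoiding R g)
    (hh : IsArcAvoiding R h) (hgh : g 1 = h 0)
    (hinter : g '' Set.Icc 0 1 ∩ h '' Set.Icc 0 1 ⊆ {h 0}) :
    IsLongArcAvoiding R (concatArc g h) := by
  have hcross : ∀ s ∈ Set.Icc (0 : ℝ) 1, ∀ t ∈ Set.Ioc (0 : ℝ) 1, g s ≠ h t := by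
    intro s hs t ht he
    have ht' : t ∈ Set.Icc (0 : ℝ) 1 := ⟨ht.1.le, ht.2⟩
    have h1 : h t = h 0 := hinter ⟨⟨s, hs, he⟩, ⟨t, ht', rfl⟩⟩
    exact ht.1.ne' (hh.injOn ht' (by simp) h1)
  have hcases : ∀ s ∈ Set.Icc (0 : ℝ) 2, (s ∈ Set.Icc (0 : ℝ) 1 ∧ concatArc g h s = g s) ∨
      (s - 1 ∈ Set.Ioc (0 : ℝ) 1 ∧ concatArc g h s = h (s - 1)) := by
    intro s hs
    rcases le_or_gt s 1 with h1 | h1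
    · exact Or.inl ⟨⟨hs.1, h1⟩, concatArc_of_le h1⟩
    · exact Or.inr ⟨⟨by linarith, by linarith [hs.2]⟩, if_neg h1.not_ge⟩
  refine ⟨?_, fun s hs t ht he => ?_, fun s hs => ?_⟩
  · have hhc := hh.continuous
    refine Continuous.if_le hg.continuous (by fun_prop) continuous_id continuous_const ?_
    rintro s rfl
    rw [sub_self, hgh]
  · rcases hcases s hs with ⟨hs', hs''⟩ | ⟨hs', hs''⟩ <;>
      rcases hcases t ht with ⟨ht', ht''⟩ | ⟨ht', ht''⟩ <;> rw [hs'', ht''] at he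
    · exact hg.injOn hs' ht' he
    · exact absurd he (hcross _ hs' _ ht')
    · exact absurd he.symm (hcross _ ht' _ hs')
    · have := hh.injOn ⟨hs'.1.le, hs'.2⟩ ⟨ht'.1.le, ht'.2⟩ he
      linarith
  · rcases hcases s hs with ⟨hs', hs''⟩ | ⟨hs', hs''⟩ <;> rw [hs'']
    · exact hg.notMem s hs'
    · exact hh.notMem _ ⟨hs'.1.le, hs'.2⟩

/-! ### The relations for edges. -/

section Relations

variable {n : ℕ} {X : Config n ℂ} {e f : Edge}

theorem Edge.coe_points_boundary_subset_carrier (e : Edge) :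
    (e.boundary.points : Set ℂ) ⊆ e.carrier := by
  rw [e.coe_points_boundary]
  rintro _ (rfl | rfl)
  · exact ⟨0, by simp, rfl⟩
  · exact ⟨1, by simp, rfl⟩

/-- Positive bands defined by disjoint edges commute. -/
theorem IsPositiveBand.mul_comm_of_disjoint
    (he : (X.points : Set ℂ) ∩ e.carrier = e.boundary.points)
    (hf : (X.points : Set ℂ) ∩ f.carrier = f.boundary.points)
    (hef : e.carrier ∩ f.carrier = ∅) {α β : BraidGroup X} (hα : IsPositiveBand X e α)
    (hβ : IsPositiveBand X f β) : α * β = β * α := by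
  have hg := e.isParam_param
  have hh := f.isParam_param
  have hdisj : Disjoint e.carrier f.carrier := Set.disjoint_iff_inter_eq_empty.2 hef
  have hα' := hα.isArcBand hg
  have hβ' := hβ.isArcBand hh
  have heX : (e.boundary.points : Set ℂ) ⊆ X.points := he ▸ Set.inter_subset_left
  have hfX : (f.boundary.points : Set ℂ) ⊆ X.points := hf ▸ Set.inter_subset_left
  have hbd : Disjoint (e.boundary.points : Set ℂ) f.boundary.points :=
    hdisj.mono e.coe_points_boundary_subset_carrier f.coe_points_boundary_subset_carrier
  set R : Set ℂ := ((X.points : Set ℂ) \ e.boundary.points) \ f.boundary.points with hR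
  have h1 : (X.points : Set ℂ) \ e.boundary.points = (f.boundary.points : Set ℂ) ∪ R := by
    rw [hR, Set.union_sdiff_cancel]
    exact Set.subset_sdiff.2 ⟨hfX, hbd.symm⟩
  have h2 : (X.points : Set ℂ) \ f.boundary.points = (e.boundary.points : Set ℂ) ∪ R := by
    rw [hR, sdiff_right_comm, Set.union_sdiff_cancel]
    exact Set.subset_sdiff.2 ⟨heX, hbd⟩
  have hX : (X.points : Set ℂ) =
      (e.boundary.points : Set ℂ) ∪ ((f.boundary.points : Set ℂ) ∪ R) := by
    rw [← h1, Set.union_sdiff_cancel heX]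
  rw [h1, hh.pair_eq] at hα'
  rw [h2, hg.pair_eq] at hβ'
  rw [hg.pair_eq, hh.pair_eq] at hX
  exact (hα'.trans_comm
    (hg.isArcAvoiding ((disjoint_carrier_diff he).mono_right Set.sdiff_subset))
    (hh.isArcAvoiding ((disjoint_carrier_diff hf).mono_right
      (by rw [h2]; exact Set.subset_union_right)))
    (by rw [hg.image_eq, hh.image_eq]; exact hdisj) hX hβ').symm

/-- Positive bands defined by edges that meet exactly in a common endpoint satisfy the braid
relation. -/
theorem IsPositiveBand.braid_relation
    (he : (X.points : Set ℂ) ∩ e.carrier = e.boundary.points)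
    (hf : (X.points : Set ℂ) ∩ f.carrier = f.boundary.points) {x : ℂ}
    (hef : e.carrier ∩ f.carrier = {x})
    (hx : x ∈ (e.boundary.points : Set ℂ) ∩ f.boundary.points) {α β : BraidGroup X}
    (hα : IsPositiveBand X e α) (hβ : IsPositiveBand X f β) : α * β * α = β * α * β := by
  obtain ⟨g, hg, hg1, d, hd, hderiv⟩ := e.exists_isParam_one_eq hx.1
  obtain ⟨h, hh, hh0⟩ := f.exists_isParam_zero_eq hx.2
  have hα' := hα.isArcBand hg
  have hβ' := hβ.isArcBand hh
  have heX : (e.boundary.points : Set ℂ) ⊆ X.points := he ▸ Set.inter_subset_left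
  have hfX : (f.boundary.points : Set ℂ) ⊆ X.points := hf ▸ Set.inter_subset_left
  have hgh : g 1 = h 0 := hg1.trans hh0.symm
  have hmeet : ∀ z ∈ e.carrier, z ∈ f.carrier → z = x := fun z hz hz' => by
    have : z ∈ e.carrier ∩ f.carrier := ⟨hz, hz'⟩
    rwa [hef] at this
  have hg01 : g 0 ≠ x := fun h0 =>
    zero_ne_one (hg.injOn (by simp) (by simp) (h0.trans hg1.symm))
  have hh01 : h 1 ≠ x := fun h1 =>
    zero_ne_one (hh.injOn (by simp) (by simp) (hh0.trans h1.symm))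
  have hg0e : g 0 ∈ (e.boundary.points : Set ℂ) := hg.pair_eq ▸ Or.inl rfl
  have hh1f : h 1 ∈ (f.boundary.points : Set ℂ) := hh.pair_eq ▸ Or.inr rfl
  have hne : g 0 ≠ h 1 := fun h0 => hg01 (hmeet _ (e.coe_points_boundary_subset_carrier hg0e)
    (h0 ▸ f.coe_points_boundary_subset_carrier hh1f))
  set R : Set ℂ := (X.points : Set ℂ) \ {g 0, x, h 1} with hR
  have h1 : (X.points : Set ℂ) \ e.boundary.points = {h 1} ∪ R := by
    have := hfX hh1f
    rw [hg.pair_eq, hg1, hR]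
    ext z
    simp only [Set.mem_sdiff, Set.mem_insert_iff, Set.mem_singleton_iff, Set.mem_union]
    constructor
    · tauto
    · rintro (rfl | h')
      · exact ⟨this, by simp [hne.symm, hh01]⟩
      · tauto
  have h2 : (X.points : Set ℂ) \ f.boundary.points = {g 0} ∪ R := by
    have := heX hg0e
    rw [hh.pair_eq, hh0, hR]
    ext z
    simp only [Set.mem_sdiff, Set.mem_insert_iff, Set.mem_singleton_iff, Set.mem_union]
    constructor
    · tauto
    · rintro (rfl | h')
      · exact ⟨this, by simp [hne, hg01]⟩
      · tauto
  have hX : (X.points : Set ℂ) = {g 0, g 1} ∪ ({h 1} ∪ R) := by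
    rw [← h1, ← hg.pair_eq, Set.union_sdiff_cancel heX]
  rw [h1] at hα'
  rw [h2] at hβ'
  have hgR : IsArcAvoiding R g := hg.isArcAvoiding ((disjoint_carrier_diff he).mono_right
    (by rw [h1]; exact Set.subset_union_right))
  have hhR : IsArcAvoiding R h := hh.isArcAvoiding ((disjoint_carrier_diff hf).mono_right
    (by rw [h2]; exact Set.subset_union_right))
  have hlong : IsLongArcAvoiding R (concatArc g h) := isLongArcAvoiding_concatArc hgR hhR hgh
    (by rw [hg.image_eq, hh.image_eq, hef, hh0])
  have hk0 : concatArc g h 0 = g 0 := concatArc_of_le zero_le_one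
  have hk1 : concatArc g h 1 = g 1 := concatArc_of_le le_rfl
  have hk2 : concatArc g h 2 = h 1 := by
    rw [← concatArc_one_add hgh zero_le_one]; norm_num
  -- The edge `e` is parametrized towards the common endpoint, so the initial point of the
  -- concatenation is a free endpoint, near which it is smooth.
  have hev : g =ᶠ[𝓝 0] concatArc g h := by
    filter_upwards [Iio_mem_nhds (zero_lt_one' ℝ)] with s hs
    exact (concatArc_of_le (le_of_lt hs)).symm
  have hrel := BraidRelation.of_hasStrictDerivAt hlong (by rw [hk0, hk1, hk2, hX]) hd
    (hderiv.congr_of_eventuallyEq hev) α β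
    (by rw [hk2]; exact hα'.congr fun s hs => (concatArc_of_le hs.2).symm)
    (by rw [hk0]; exact hβ'.congr fun s hs => (concatArc_one_add hgh hs.1).symm)
  rw [mul_assoc, mul_assoc]
  -- Both words are palindromes, so the order in which products compose loops is immaterial.
  simp only [FundamentalGroup.mul_def, Path.Homotopic.Quotient.trans_assoc]
  exact hrel

end Relations

theorem mainTheorem7 {n : ℕ} (hn : 2 ≤ n) (X : Config n ℂ) (e f : Edge)
    (he : (X.points : Set ℂ) ∩ e.carrier = e.boundary.points)
    (hf : (X.points : Set ℂ) ∩ f.carrier = f.boundary.points) :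
    (∃! β : BraidGroup X, IsPositiveBand X e β) ∧
    (∃! β : BraidGroup X, IsPositiveBand X f β) ∧
    ∀ βe βf : BraidGroup X, IsPositiveBand X e βe → IsPositiveBand X f βf →
      (e.carrier ∩ f.carrier = ∅ → ⁅βe, βf⁆ = 1) ∧
      (∀ x : ℂ, e.carrier ∩ f.carrier = {x} →
        x ∈ (e.boundary.points : Set ℂ) ∩ f.boundary.points → yangBaxter βe βf = 1) := by
  refine ⟨existsUnique_isPositiveBand he, existsUnique_isPositiveBand hf,
    fun βe βf hβe hβf => ⟨fun hef => ?_, fun x hef hx => ?_⟩⟩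
  · exact commutatorElement_eq_one_iff_mul_comm.2 (hβe.mul_comm_of_disjoint he hf hef hβf)
  · rw [yangBaxter, hβe.braid_relation he hf hef hx hβf]
    group
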